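/- **Setting.** A request $r=(a,b;t)$ consists of a start $a$, a destination $b$ (points of a metric space $M$) and a release time $t$; a request sequence $\sigma=(r_1,\dots,r_n)$, $n\ge 1$, has release times $0<t_1<\dots<t_n$. A single server of capacity $c\in\{1,2,\dots\}\cup\{\infty\}$ starts at an origin $O\in M$ at time $0$, moves with speed at most one, collects each request at its start (not before its release time), never carries more than $c$ requests at once, and unloads a request only at its destination (no preemption); it need not return to $O$. As usual, motion is continuous: the server moves in a geodesic metric space $X$ that contains $M$ isometrically ($X=M$ if $M$ is geodesic; every metric space has such an $X$). $\mathrm{Opt}(t)$ denotes the infimum of the completion times of offline solutions (knowing all requests in advance, respecting release times) for the requests released up to time $t$, and $\mathrm{Opt}(\sigma)$ that for all of $\sigma$. For a finite set $R$ of requests and a point $x$, $S(R,x)$ denotes a shortest schedule starting at $x$ and serving $R$, ignoring release times. **The algorithm $\mathrm{Lazy}(\alpha)$, $\alpha\ge 1$.** *Upon receiving a request* at time $t$: if the server can deliver all loaded requests and then reach $O$ by time $\alpha\,\mathrm{Opt}(t)$, it aborts its current command and delivers its loaded requests and returns to $O$ in a shortest way; otherwise it goes on with its current command. *Upon becoming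 (or being) idle* at time $t$, after a request released at that same time has been received: if $t<\alpha\,\mathrm{Opt}(t)$, it waits at its position until time $\alpha\,\mathrm{Opt}(t)$; otherwise, if the set $R_t$ of known unserved requests is non-empty, it follows $S(R_t,p_t)$ from its position $p_t$; otherwise it stays idle. Ties between shortest schedules, and between shortest ways to deliver and return, are broken by a fixed rule: a function of $(R,x)$, respectively of the position and the set of loaded requests. The competitive ratio of $\mathrm{Lazy}(\alpha)$ is $\sup_\sigma \mathrm{Lazy}(\alpha)(\sigma)/\mathrm{Opt}(\sigma)$, where $\mathrm{Lazy}(\alpha)(\sigma)\in[0,\infty]$ is the time at which all requests of $\sigma$ have been served. **Theorem.** Let $\varphi=\frac{1+\sqrt5}{2}$ and let $c\in\{1,2,\dots\}\cup\{\infty\}$. 1. For every metric space $M$, every origin $O\in M$ and every geodesic space $X$ containing $M$ isometrically, tie-breaking rules exist (that is, all the shortest schedules above exist), and for every tie-breaking rule $\mathrm{Lazy}(\varphi)$ has competitive ratio at most $1+\varphi$. The bound is tight: on the real line with origin $0$, $\mathrm{Lazy}(\varphi)$ has competitive ratio exactly $1+\varphi$, for every tie-breaking rule. 2. For every $\alpha\ge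 1$ and every tie-breaking rule, $\mathrm{Lazy}(\alpha)$ has competitive ratio at least $\max\{1+\alpha,\ 2+\frac{2}{3\alpha}\}$ on the real line with origin $0$. -/

import Mathlib

namespace DialARide

universe u

/-- A transportation request `(a, b; t)`: start `a`, destination `b`, release time `t`. -/
@[ext]
structure Request (X : Type u) where
  src : X
  dst : X
  rel : ℝ

/-- The actions of a server: collecting a request and unloading it. -/
inductive Act (X : Type u) where
  | load (r : Request X)
  | unload (r : Request X)

noncomputable instance (X : Type u) : DecidableEq (Request X) := Classical.decEq _

noncomputable instance (X : Type u) : DecidableEq (Act X) := Classical.decEq _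

/-- Where an action has to take place; a request is only unloaded at its destination. -/
def Act.point {X : Type u} : Act X → X
  | .load r => r.src
  | .unload r => r.dst

/-- `Serves c P L l`: a server of capacity `c` which carries the requests `L` can perform the
actions `l` in this order; doing so, it delivers everything in `L`, collects and delivers every
request in `P`, and ends up empty. -/
def Serves {X : Type u} (c : ℕ∞) :
    Finset (Request X) → Finset (Request X) → List (Act X) → Prop
  | P, L, [] => P = ∅ ∧ L = ∅
  | P, L, Act.load r :: l =>
      r ∈ P ∧ (L.card : ℕ∞) + 1 ≤ c ∧ Serves c (P.erase r) (insert r L) l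
  | P, L, Act.unload r :: l => r ∈ L ∧ Serves c P (L.erase r) l

/-- A schedule: the position of the server at each time in `[0, dur]` and the list of the actions
that are performed, with the times at which they are performed. Times are measured from the start
of the schedule. -/
structure Tour (X : Type u) where
  dur : ℝ
  path : ℝ → X
  acts : List (ℝ × Act X)

/-- Stay at `x` for `s` time units. -/
def Tour.stay {X : Type u} (x : X) (s : ℝ) : Tour X where
  dur := s
  path := fun _ => x
  acts := []

/-- `T` can be executed by a server of capacity `c` and speed at most one that starts at `x` with
the requests `L` on board, and it serves exactly the requests in `P` and in `L`. -/
structure Tour.IsFeasible {X : Type u} [MetricSpace X] (c : ℕ∞) (P L : Finset (Request X))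
    (x : X) (T : Tour X) : Prop where
  dur_nonneg : 0 ≤ T.dur
  path_zero : T.path 0 = x
  speed : LipschitzOnWith 1 T.path (Set.Icc 0 T.dur)
  sorted : (T.acts.map Prod.fst).Pairwise (· ≤ ·)
  time_mem : ∀ p ∈ T.acts, p.1 ∈ Set.Icc 0 T.dur
  path_time : ∀ p ∈ T.acts, T.path p.1 = p.2.point
  serves : Serves c P L (T.acts.map Prod.snd)

/-- No request is collected before it is released (for a schedule that starts at time `0`). -/
def Tour.RespectsRelease {X : Type u} (T : Tour X) : Prop :=
  ∀ s r, (s, Act.load r) ∈ T.acts → r.rel ≤ s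

/-- `T` is a shortest schedule that starts at `x` and serves all requests in `R`, ignoring
release times. -/
def Tour.IsShortest {X : Type u} [MetricSpace X] (c : ℕ∞) (R : Finset (Request X)) (x : X)
    (T : Tour X) : Prop :=
  T.IsFeasible c R ∅ x ∧ ∀ T' : Tour X, T'.IsFeasible c R ∅ x → T.dur ≤ T'.dur

/-- `T` is a shortest way to deliver the loaded requests `L`, starting at `x`, and to go to `O`
afterwards. -/
def Tour.IsShortestReturn {X : Type u} [MetricSpace X] (c : ℕ∞) (O x : X)
    (L : Finset (Request X)) (T : Tour X) : Prop :=
  (T.IsFeasible c ∅ L x ∧ T.path T.dur = O) ∧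
    ∀ T' : Tour X, T'.IsFeasible c ∅ L x → T'.path T'.dur = O → T.dur ≤ T'.dur

/-- The offline optimum: the best completion time for the set `R` of requests, of a server that
starts at `O` at time `0`, knows all of `R`, and has to respect the release times. -/
noncomputable def opt {X : Type u} [MetricSpace X] (c : ℕ∞) (O : X) (R : Finset (Request X)) : ℝ :=
  sInf {s | ∃ T : Tour X, T.IsFeasible c R ∅ O ∧ T.RespectsRelease ∧ T.dur = s}

/-- Any two points are joined by a curve whose length is their distance, so that a server of unit
speed can travel from `x` to `y` in time `dist x y`. -/
def IsGeodesic (X : Type u) [MetricSpace X] : Prop :=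
  ∀ x y : X, ∃ γ : ℝ → X, γ 0 = x ∧ γ (dist x y) = y ∧
    ∀ s ∈ Set.Icc 0 (dist x y), ∀ t ∈ Set.Icc 0 (dist x y), dist (γ s) (γ t) = |s - t|

/-- A tie-breaking rule for `Lazy`: a choice of the shortest schedule `S(R, x)` for all `R` and
`x`, and a choice of an optimal execution of the command `deliver_and_return` for every position
`x` and set `L` of loaded requests. -/
structure LazyRule {X : Type u} [MetricSpace X] (c : ℕ∞) (O : X) where
  sched : Finset (Request X) → X → Tour X
  ret : X → Finset (Request X) → Tour X
  sched_shortest : ∀ R x, (sched R x).IsShortest c R x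
  ret_shortest : ∀ x L, (ret x L).IsShortestReturn c O x L

/-- A configuration in the execution of `Lazy`: the requests not yet released (hidden from the
server), the requests released so far, and the current command, which is the schedule `tour`
started at time `start`. The requests in `loaded` are on board at time `start`; those in `waiting`
are the requests among `known` that have not been collected before time `start`. -/
structure Config (X : Type u) where
  future : List (Request X)
  known : Finset (Request X)
  waiting : Finset (Request X)
  loaded : Finset (Request X)
  start : ℝ
  tour : Tour X

namespace Config

variable {X : Type u}

/-- The time at which the current command is completed. -/
noncomputable def finish (C : Config X) : ℝ := C.start + C.tour.dur

/-- The actions of the current command that have been performed by time `t`. -/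
noncomputable def executed (C : Config X) (t : ℝ) : List (Act X) :=
  (C.tour.acts.filter fun p => decide (C.start + p.1 ≤ t)).map Prod.snd

/-- The position of the server at time `t`. -/
noncomputable def posAt (C : Config X) (t : ℝ) : X := C.tour.path (t - C.start)

/-- The known requests that have not been collected by time `t`. -/
noncomputable def waitingAt (C : Config X) (t : ℝ) : Finset (Request X) :=
  C.waiting.filter fun r => Act.load r ∉ C.executed t

/-- The requests on board at time `t`. -/
noncomputable def loadedAt (C : Config X) (t : ℝ) : Finset (Request X) :=
  (C.loaded ∪ C.waiting.filter fun r => Act.load r ∈ C.executed t).filter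
    fun r => Act.unload r ∉ C.executed t

/-- Abort the current command at time `t` and execute the command `T`. -/
noncomputable def execute (C : Config X) (t : ℝ) (T : Tour X) : Config X :=
  { C with
    waiting := C.waitingAt t
    loaded := C.loadedAt t
    start := t
    tour := T }

/-- The server starts at the origin at time `0`, without anything to do. -/
def init (O : X) (σ : List (Request X)) : Config X where
  future := σ
  known := ∅
  waiting := ∅
  loaded := ∅
  start := 0
  tour := Tour.stay O 0

/-- The request `r` becomes known; the current command is not affected. -/
noncomputable def reveal (C : Config X) (r : Request X) (rest : List (Request X)) : Config X :=
  { C with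
    future := rest
    known := insert r C.known
    waiting := insert r C.waiting }

variable [MetricSpace X] {c : ℕ∞} {O : X}

/-- Upon receiving the request `r` (at time `r.rel`): if the loaded requests can be served and the
origin can be reached until time `α * Opt(r.rel)`, then execute `deliver_and_return`; otherwise go
on with the current command. -/
noncomputable def receive (A : LazyRule c O) (α : ℝ) (C : Config X) (r : Request X)
    (rest : List (Request X)) : Config X :=
  let C' := C.reveal r rest
  let T := A.ret (C'.posAt r.rel) (C'.loadedAt r.rel)
  if r.rel + T.dur ≤ α * opt c O C'.known then C'.execute r.rel T else C'

/-- Upon becoming idle, at time `t = C.finish`: if `t < α * Opt(t)`, wait until `α * Opt(t)`;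
otherwise, if there are unserved requests, follow a shortest schedule for them; otherwise remain
idle at the current position until the next request is released, if there is one. -/
noncomputable def becomeIdle (A : LazyRule c O) (α : ℝ) (C : Config X) : Config X :=
  let t := C.finish
  if t < α * opt c O C.known then
    C.execute t (Tour.stay (C.posAt t) (α * opt c O C.known - t))
  else if (C.waitingAt t).Nonempty then
    C.execute t (A.sched (C.waitingAt t) (C.posAt t))
  else
    match C.future with
    | [] => C
    | r :: _ => C.execute t (Tour.stay (C.posAt t) (r.rel - t))

/-- The next event: either a request is released during (or at the end of) the current command, or
the current command is completed. -/
noncomputable def next (A : LazyRule c O) (α : ℝ) (C : Config X) : Config X :=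
  match C.future with
  | [] => C.becomeIdle A α
  | r :: rest => if r.rel ≤ C.finish then C.receive A α r rest else C.becomeIdle A α

end Config

/-- The configuration of `Lazy(α)` on the request sequence `σ` after `m` events. -/
noncomputable def lazyRun {X : Type u} [MetricSpace X] {c : ℕ∞} {O : X} (A : LazyRule c O) (α : ℝ)
    (σ : List (Request X)) (m : ℕ) : Config X :=
  (Config.next A α)^[m] (Config.init O σ)

/-- At time `t`, all requests of `σ` have been released and served by `Lazy(α)`. -/
def LazyDone {X : Type u} [MetricSpace X] {c : ℕ∞} {O : X} (A : LazyRule c O) (α : ℝ)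
    (σ : List (Request X)) (t : ℝ) : Prop :=
  ∃ m, (lazyRun A α σ m).future = [] ∧ (lazyRun A α σ m).start ≤ t ∧
    (lazyRun A α σ m).waitingAt t = ∅ ∧ (lazyRun A α σ m).loadedAt t = ∅

/-- The completion time of `Lazy(α)` on `σ`; it is `∞` if some request is never served. -/
noncomputable def lazyTime {X : Type u} [MetricSpace X] {c : ℕ∞} {O : X} (A : LazyRule c O) (α : ℝ)
    (σ : List (Request X)) : ENNReal :=
  ⨅ (t : ℝ) (_ : LazyDone A α σ t), ENNReal.ofReal t

/-- A (non-empty) request sequence with locations in `M` and release times `0 < t₁ < ⋯ < tₙ`. -/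
structure IsRequestSequence {X : Type u} (M : Set X) (σ : List (Request X)) : Prop where
  ne_nil : σ ≠ []
  rel_pos : ∀ r ∈ σ, 0 < r.rel
  rel_lt : σ.Pairwise fun r r' => r.rel < r'.rel
  src_mem : ∀ r ∈ σ, r.src ∈ M
  dst_mem : ∀ r ∈ σ, r.dst ∈ M

/-- The (strict) competitive ratio of `Lazy(α)` for requests with locations in `M`. -/
noncomputable def lazyRatio {X : Type u} [MetricSpace X] {c : ℕ∞} {O : X} (A : LazyRule c O)
    (α : ℝ) (M : Set X) : ENNReal :=
  ⨆ (σ : List (Request X)) (_ : IsRequestSequence M σ),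
    lazyTime A α σ / ENNReal.ofReal (opt c O σ.toFinset)

end DialARide

open DialARide

namespace DialARide

universe u

variable {X : Type u} {c : ℕ∞}

/-! Upper bound. Write φ for the golden ratio, so φ² = φ + 1. The claim is that every schedule
begins at time exactly φ·opt, for the current value of `opt`, and takes at most `opt`. From the
origin its length is at most `opt`, because an offline solution may forget release times. Otherwise
the server stands at a destination, after a schedule begun when the optimum was `Q`; that schedule
ended by (1 + φ)Q = φ²Q, within distance `Q` of the origin. The waiting requests were released after
φQ, so φ²Q ≤ φ·opt and the server is not late. As it refused to return, φ·opt < (2 + φ)Q, hence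
`opt` < 2φQ: the optimum spends less than half its time on the new requests. Then
`Tour.IsShortest.dur_le_opt_of_lt` bounds the new schedule by `opt`. `Config.IsHome` and
`Config.IsAway` record this alternative; `Config.IsReachable.receive` and `Config.IsReachable.next`
propagate it, with `Config.rank` giving termination.

Lower bounds. One request at distance 1 costs 1 offline, but the server leaves only at time α
(`one_add_le_lazyRatio`). For small α, two opposite requests at the origin start a schedule of
length 3; a third, far out on the side visited first, appears when it is too late to turn back
(`le_lazyRatio_of_small`).

All tours are handled through timed action lists (`Reach`), which in a geodesic space carry the same
information as paths. -/

/-- The request that an action deals with. -/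
def Act.req : Act X → Request X
  | .load r => r
  | .unload r => r

/-! ### Combinatorics of action lists -/

namespace Serves

variable {P L : Finset (Request X)} {l : List (Act X)}

theorem eq_nil (h : Serves c ∅ (∅ : Finset (Request X)) l) : l = [] := by
  cases l with
  | nil => rfl
  | cons a l => cases a <;> simp [Serves] at h

/-- A list of actions can be restricted to the requests in a set `R`. -/
theorem restrict (R : Finset (Request X)) (h : Serves c P L l) :
    Serves c (P ∩ R) (L ∩ R) (l.filter fun a => decide (a.req ∈ R)) := by
  induction l generalizing P L with
  | nil => simp_all [Serves]
  | cons a l ih =>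
    cases a with
    | load r =>
      obtain ⟨hr, hc, h⟩ := h
      have := ih h
      by_cases hR : r ∈ R
      · rw [List.filter_cons_of_pos (by exact decide_eq_true hR)]
        refine ⟨by simp [hr, hR], le_trans ?_ hc, ?_⟩
        · gcongr
          exact Finset.inter_subset_left
        · rwa [Finset.erase_inter, Finset.insert_inter_of_mem hR] at this
      · rw [List.filter_cons_of_neg (by exact mt of_decide_eq_true hR)]
        rwa [Finset.erase_inter, Finset.insert_inter_of_notMem hR,
          Finset.erase_eq_of_notMem (by simp [hR])] at this
    | unload r =>
      obtain ⟨hr, h⟩ := h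
      have := ih h
      by_cases hR : r ∈ R
      · rw [List.filter_cons_of_pos (by exact decide_eq_true hR)]
        refine ⟨by simp [hr, hR], ?_⟩
        rwa [Finset.erase_inter] at this
      · rw [List.filter_cons_of_neg (by exact mt of_decide_eq_true hR)]
        rwa [Finset.erase_inter, Finset.erase_eq_of_notMem (s := L ∩ R) (by simp [hR])] at this

/-- The state of the server after performing the first part of a list of actions. -/
theorem of_append {l₁ l₂ : List (Act X)} (hd : Disjoint P L) (h : Serves c P L (l₁ ++ l₂)) :
    Serves c (P.filter fun r => Act.load r ∉ l₁)
      ((L ∪ P.filter fun r => Act.load r ∈ l₁).filter fun r => Act.unload r ∉ l₁) l₂ := by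
  induction l₁ generalizing P L with
  | nil => simpa using h
  | cons a l ih =>
    rw [Finset.disjoint_left] at hd
    cases a with
    | load r =>
      obtain ⟨hr, hc, h⟩ := h
      have hd' : Disjoint (P.erase r) (insert r L) := by
        rw [Finset.disjoint_left]
        intro x hx
        simp only [Finset.mem_erase] at hx
        simp [hx.1, hd hx.2]
      convert ih hd' h using 1
      · ext x
        simp only [Finset.mem_filter, List.mem_cons, Act.load.injEq, Finset.mem_erase]
        tauto
      · ext x
        simp only [Finset.mem_filter, List.mem_cons, Act.load.injEq, Finset.mem_erase,
          Finset.mem_union, Finset.mem_insert, reduceCtorEq, false_or]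
        by_cases hx : x = r
        · subst hx; simp [hr]
        · simp [hx]
    | unload r =>
      obtain ⟨hr, h⟩ := h
      have hd' : Disjoint P (L.erase r) := by
        rw [Finset.disjoint_left]
        intro x hx
        simp [hd hx]
      convert ih hd' h using 1
      · ext x
        simp
      · ext x
        simp only [Finset.mem_filter, List.mem_cons, Act.unload.injEq, Finset.mem_erase,
          Finset.mem_union, reduceCtorEq, false_or]
        by_cases hx : x = r
        · subst hx
          have : x ∉ P := fun h => hd h hr
          simp [this]
        · simp [hx]

theorem load_mem_iff (h : Serves c P L l) (r : Request X) : Act.load r ∈ l ↔ r ∈ P := by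
  induction l generalizing P L with
  | nil => simp [h.1]
  | cons a l ih =>
    cases a with
    | load q =>
      obtain ⟨hq, hc, h⟩ := h
      rw [List.mem_cons, ih h, Act.load.injEq, Finset.mem_erase]
      by_cases hx : r = q
      · subst hx; simp [hq]
      · simp [hx]
    | unload q =>
      obtain ⟨hq, h⟩ := h
      rw [List.mem_cons, ih h]
      simp

theorem unload_mem (h : Serves c P L l) {r : Request X} (hr : r ∈ P ∪ L) :
    Act.unload r ∈ l := by
  induction l generalizing P L with
  | nil => simp [h.1, h.2] at hr
  | cons a l ih =>
    cases a with
    | load q =>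
      obtain ⟨hq, hc, h⟩ := h
      refine List.mem_cons_of_mem _ (ih h ?_)
      by_cases hx : r = q
      · simp [hx]
      · simpa [hx] using hr
    | unload q =>
      obtain ⟨hq, h⟩ := h
      by_cases hx : r = q
      · simp [hx]
      · exact List.mem_cons_of_mem _ (ih h (by simpa [hx] using hr))

theorem req_mem (h : Serves c P L l) {a : Act X} (ha : a ∈ l) : a.req ∈ P ∪ L := by
  induction l generalizing P L with
  | nil => simp at ha
  | cons b l ih =>
    cases b with
    | load q =>
      obtain ⟨hq, hc, h⟩ := h
      rcases List.mem_cons.1 ha with rfl | ha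
      · simp [Act.req, hq]
      · have := ih h ha
        simp only [Finset.mem_union, Finset.mem_erase, Finset.mem_insert] at this ⊢
        rcases this with h | h | h
        · exact Or.inl h.2
        · exact Or.inl (h ▸ hq)
        · exact Or.inr h
    | unload q =>
      obtain ⟨hq, h⟩ := h
      rcases List.mem_cons.1 ha with rfl | ha
      · simp [Act.req, hq]
      · have := ih h ha
        simp only [Finset.mem_union, Finset.mem_erase] at this ⊢
        tauto

/-- Requests in `P` need two actions and those in `L` one. Without disjointness, `insert r L` could
merge two copies of a request. -/
theorem length_eq (h : Serves c P L l) (hd : Disjoint P L) : l.length = 2 * P.card + L.card := by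
  induction l generalizing P L with
  | nil => simp [h.1, h.2]
  | cons a l ih =>
    rw [Finset.disjoint_left] at hd
    cases a with
    | load r =>
      obtain ⟨hr, hc, h⟩ := h
      have := ih h (by
        rw [Finset.disjoint_left]
        intro x hx
        simp only [Finset.mem_erase] at hx
        simp [hx.1, hd hx.2])
      rw [Finset.card_insert_of_notMem (hd hr), Finset.card_erase_of_mem hr] at this
      have := Finset.card_pos.2 ⟨r, hr⟩
      simp only [List.length_cons]
      omega
    | unload r =>
      obtain ⟨hr, h⟩ := h
      have := ih h (by
        rw [Finset.disjoint_left]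
        intro x hx
        simp [hd hx])
      rw [Finset.card_erase_of_mem hr] at this
      have := Finset.card_pos.2 ⟨r, hr⟩
      simp only [List.length_cons]
      omega

/-- The last action of a server is to unload a request. -/
theorem exists_eq_append_unload (h : Serves c P L l) (hne : (P ∪ L).Nonempty) :
    ∃ l' q, q ∈ P ∪ L ∧ l = l' ++ [Act.unload q] := by
  suffices ∃ l' q, l = l' ++ [Act.unload q] by
    obtain ⟨l', q, rfl⟩ := this
    exact ⟨l', q, h.req_mem (a := Act.unload q) (by simp), rfl⟩
  induction l generalizing P L with
  | nil => simp [h.1, h.2] at hne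
  | cons a l ih =>
    cases a with
    | load r =>
      obtain ⟨l', q, rfl⟩ := ih h.2.2 ⟨r, by simp⟩
      exact ⟨Act.load r :: l', q, rfl⟩
    | unload r =>
      rcases (P ∪ L.erase r).eq_empty_or_nonempty with he | he
      · rw [Finset.union_eq_empty] at he
        have h2 := h.2
        rw [he.1, he.2] at h2
        exact ⟨[], r, by rw [h2.eq_nil]; rfl⟩
      · obtain ⟨l', q, rfl⟩ := ih h.2 he
        exact ⟨Act.unload r :: l', q, rfl⟩

theorem singleton {r : Request X} (h : Serves c {r} ∅ l) : l = [Act.load r, Act.unload r] := by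
  match l, h with
  | [], h => simp [Serves] at h
  | Act.unload q :: l, h => simp [Serves] at h
  | Act.load q :: l, h =>
    obtain ⟨hq, -, h⟩ := h
    rw [Finset.mem_singleton] at hq
    subst hq
    match l, h with
    | [], h => simp [Serves] at h
    | Act.load p :: l, h => simp [Serves] at h
    | Act.unload p :: l, h =>
      obtain ⟨hp, h⟩ := h
      have hp : p = q := by simpa using hp
      subst hp
      have : l = [] := eq_nil (c := c) (by simpa using h)
      rw [this]

/-- Everything that is on board can be delivered. -/
theorem exists_unload (L : Finset (Request X)) : ∃ l, Serves c ∅ L l := by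
  induction L using Finset.induction_on with
  | empty => exact ⟨[], rfl, rfl⟩
  | insert r L hr ih =>
    obtain ⟨l, hl⟩ := ih
    exact ⟨Act.unload r :: l, by simp, by rwa [Finset.erase_insert hr]⟩

/-- A request can be served before all others. -/
theorem cons_cons (hc : 1 ≤ c) {r : Request X} (hr : r ∉ P) (h : Serves c P ∅ l) :
    Serves c (insert r P) ∅ (Act.load r :: Act.unload r :: l) := by
  refine ⟨by simp, by simpa using hc, by simp, ?_⟩
  rw [Finset.erase_insert hr]
  simpa using h

/-- Requests can be served one after the other. -/
theorem exists_serves (hc : 1 ≤ c) (P : Finset (Request X)) : ∃ l, Serves c P ∅ l := by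
  induction P using Finset.induction_on with
  | empty => exact ⟨[], rfl, rfl⟩
  | insert r P hr ih =>
    obtain ⟨l, hl⟩ := ih
    exact ⟨_, hl.cons_cons hc hr⟩

/-- The words have fixed length over a finite alphabet. This is what makes shortest schedules exist.
-/
theorem finite_setOf (hd : Disjoint P L) : {l : List (Act X) | Serves c P L l}.Finite := by
  classical
  let A : Finset (Act X) := (P ∪ L).image Act.load ∪ (P ∪ L).image Act.unload
  have hA : ∀ l, Serves c P L l → ∀ a ∈ l, a ∈ A := by
    intro l hl a ha
    have := hl.req_mem ha
    cases a <;> simpa [A, Act.req] using this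
  refine ((List.finite_length_eq A (2 * P.card + L.card)).image (List.map Subtype.val)).subset ?_
  intro l hl
  refine ⟨l.attachWith _ (hA l hl), ?_, by simp⟩
  simp [length_eq hl hd]

end Serves

end DialARide

namespace DialARide

universe u

variable {X : Type u} {c : ℕ∞}

/-! ### Timed action lists and motion in geodesic spaces -/

section Reach

variable [MetricSpace X]

/-- A server of unit speed which is at `x` at time `t` can perform the actions `l` at the
prescribed times and be at `z` at time `D`. -/
def Reach : ℝ → X → List (ℝ × Act X) → ℝ → X → Prop
  | t, x, [], D, z => dist x z ≤ D - t
  | t, x, p :: l, D, z => dist x p.2.point ≤ p.1 - t ∧ Reach p.1 p.2.point l D z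

variable {t s D D' : ℝ} {x y z w : X} {l l' : List (ℝ × Act X)}

namespace Reach

theorem of_le (h : dist x y ≤ s - t) (hl : Reach s y l D z) : Reach t x l D z := by
  cases l with
  | nil =>
    simp only [Reach] at hl ⊢
    linarith [dist_triangle x y z]
  | cons p l =>
    simp only [Reach] at hl ⊢
    exact ⟨by linarith [dist_triangle x y p.2.point], hl.2⟩

theorem extend (hl : Reach t x l D z) (h : dist z w ≤ D' - D) : Reach t x l D' w := by
  induction l generalizing t x with
  | nil =>
    simp only [Reach] at hl ⊢
    linarith [dist_triangle x z w]
  | cons p l ih => exact ⟨hl.1, ih hl.2⟩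

/-- Skipping a stop is harmless by the triangle inequality. This turns a tour for many requests into
one for some of them. -/
theorem sublist (h : l'.Sublist l) (hl : Reach t x l D z) : Reach t x l' D z := by
  induction h generalizing t x with
  | slnil => exact hl
  | cons p h ih => exact ih (of_le hl.1 hl.2)
  | cons_cons p h ih => exact ⟨hl.1, ih hl.2⟩

theorem dist_le (hl : Reach t x l D z) : dist x z ≤ D - t :=
  sublist (l' := []) (List.nil_sublist _) hl

theorem of_mem (hl : Reach t x l D z) {p : ℝ × Act X} (hp : p ∈ l) :
    dist x p.2.point ≤ p.1 - t ∧ dist p.2.point z ≤ D - p.1 :=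
  sublist (l' := [p]) (List.singleton_sublist.2 hp) hl

theorem mem_Icc (hl : Reach t x l D z) {p : ℝ × Act X} (hp : p ∈ l) : p.1 ∈ Set.Icc t D := by
  have h := hl.of_mem hp
  have h₁ := dist_nonneg.trans h.1
  have h₂ := dist_nonneg.trans h.2
  constructor <;> linarith

theorem sorted (hl : Reach t x l D z) : (l.map Prod.fst).Pairwise (· ≤ ·) := by
  induction l generalizing t x with
  | nil => simp
  | cons p l ih =>
    rw [List.map_cons, List.pairwise_cons]
    refine ⟨?_, ih hl.2⟩
    intro s hs
    obtain ⟨q, hq, rfl⟩ := List.mem_map.1 hs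
    exact (hl.2.mem_Icc hq).1

theorem shift (hl : Reach t x l D z) (k : ℝ) :
    Reach (t + k) x (l.map fun p => (p.1 + k, p.2)) (D + k) z := by
  induction l generalizing t x with
  | nil =>
    simp only [Reach, List.map_nil] at hl ⊢
    linarith
  | cons p l ih =>
    refine ⟨?_, ih hl.2⟩
    have := hl.1
    simp only
    linarith

theorem of_path {f : ℝ → X} (htD : t ≤ D) (hf : LipschitzOnWith 1 f (Set.Icc t D))
    (hs : (l.map Prod.fst).Pairwise (· ≤ ·)) (hm : ∀ p ∈ l, p.1 ∈ Set.Icc t D)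
    (hp : ∀ p ∈ l, f p.1 = p.2.point) : Reach t (f t) l D (f D) := by
  induction l generalizing t with
  | nil =>
    have := hf.dist_le_mul t ⟨le_rfl, htD⟩ D ⟨htD, le_rfl⟩
    rw [Real.dist_eq, abs_sub_comm, abs_of_nonneg (sub_nonneg.2 htD)] at this
    simpa [Reach] using this
  | cons p l ih =>
    have hpm := hm p (by simp)
    have := hf.dist_le_mul t ⟨le_rfl, htD⟩ p.1 hpm
    rw [Real.dist_eq, abs_sub_comm, abs_of_nonneg (sub_nonneg.2 hpm.1)] at this
    rw [List.map_cons, List.pairwise_cons] at hs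
    refine ⟨by rw [← hp p (by simp)]; simpa using this, ?_⟩
    rw [← hp p (by simp)]
    refine ih hpm.2 (hf.mono (Set.Icc_subset_Icc_left hpm.1)) hs.2 (fun q hq => ?_)
      fun q hq => hp q (by simp [hq])
    exact ⟨hs.1 _ (List.mem_map_of_mem hq), (hm q (by simp [hq])).2⟩

end Reach

theorem IsGeodesic.exists_leg (hX : IsGeodesic X) (h : dist x y ≤ D - t) :
    ∃ f : ℝ → X, f t = x ∧ f D = y ∧ LipschitzWith 1 f := by
  obtain ⟨γ, h0, h1, hγ⟩ := hX x y
  have hd : 0 ≤ dist x y := dist_nonneg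
  -- Clamping the parameter makes the server rest at `x` until time `t`, move at unit speed, and
  -- then rest at `y`.
  have hmem : ∀ s, max 0 (min (s - t) (dist x y)) ∈ Set.Icc 0 (dist x y) := fun s =>
    ⟨le_max_left _ _, max_le hd (min_le_right _ _)⟩
  refine ⟨fun s => γ (max 0 (min (s - t) (dist x y))), by simp [h0, hd], ?_, ?_⟩
  · simp only [min_eq_right h, max_eq_right hd, h1]
  · refine LipschitzWith.of_dist_le_mul fun s s' => ?_
    rw [hγ _ (hmem s) _ (hmem s'), Real.dist_eq, NNReal.coe_one, one_mul]
    rw [max_comm 0, max_comm 0]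
    refine (abs_max_sub_max_le_abs _ _ _).trans ((abs_min_sub_min_le_max _ _ _ _).trans ?_)
    simp

theorem Reach.exists_path (hX : IsGeodesic X) (hl : Reach t x l D z) :
    ∃ f : ℝ → X, f t = x ∧ f D = z ∧ LipschitzWith 1 f ∧ ∀ p ∈ l, f p.1 = p.2.point := by
  induction l generalizing t x with
  | nil =>
    obtain ⟨f, h⟩ := hX.exists_leg hl
    exact ⟨f, h.1, h.2.1, h.2.2, by simp⟩
  | cons p l ih =>
    obtain ⟨f, hft, hfp, hf⟩ := hX.exists_leg hl.1
    obtain ⟨g, hgp, hgD, hg, hgl⟩ := ih hl.2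
    have htp : t ≤ p.1 := by linarith [dist_nonneg.trans hl.1]
    -- The two legs agree at the seam `p.1`.
    have hpg : ∀ s, p.1 ≤ s → (if s ≤ p.1 then f s else g s) = g s := by
      intro s hs
      split_ifs with h
      · rw [le_antisymm h hs, hfp, hgp]
      · rfl
    refine ⟨fun s => if s ≤ p.1 then f s else g s, by simp [htp, hft], ?_, ?_, ?_⟩
    · rw [← hgD]
      exact hpg _ (by linarith [dist_nonneg.trans hl.2.dist_le])
    · refine LipschitzWith.of_dist_le_mul fun s s' => ?_
      wlog hss : s ≤ s' generalizing s s'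
      · rw [dist_comm, dist_comm s]
        exact this s' s (le_of_not_ge hss)
      rcases le_total s' p.1 with h | h
      · simpa [h, hss.trans h] using hf.dist_le_mul s s'
      rcases le_total p.1 s with h' | h'
      · simp only [hpg _ h, hpg _ h']
        exact hg.dist_le_mul s s'
      · simp only [hpg _ h, if_pos h']
        have h1 := hf.dist_le_mul s p.1
        have h2 := hg.dist_le_mul p.1 s'
        have h3 := dist_triangle (f s) (f p.1) (g s')
        rw [hgp, ← hfp] at h2
        rw [Real.dist_eq, abs_sub_comm, abs_of_nonneg (by linarith), NNReal.coe_one] at h1 h2 ⊢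
        linarith
    · intro q hq
      rcases List.mem_cons.1 hq with rfl | hq
      · simp [hfp]
      · rw [← hgl q hq]
        exact hpg _ (hl.2.mem_Icc hq).1

end Reach

/-! ### Shortest schedules and their existence -/

section Tour

variable [MetricSpace X] {P L R : Finset (Request X)} {t D : ℝ} {x O z : X}
  {l : List (ℝ × Act X)} {T : Tour X}

theorem Tour.IsFeasible.reach_from (h : T.IsFeasible c P L x) {s : ℝ} (h0 : 0 ≤ s)
    (hs : s ≤ T.dur) (hl : l.Sublist T.acts) (hls : ∀ p ∈ l, s ≤ p.1) :
    Reach s (T.path s) l T.dur (T.path T.dur) :=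
  Reach.of_path hs (h.speed.mono (Set.Icc_subset_Icc_left h0))
    (h.sorted.sublist (hl.map _)) (fun p hp => ⟨hls p hp, (h.time_mem p (hl.subset hp)).2⟩)
    fun p hp => h.path_time p (hl.subset hp)

theorem Tour.IsFeasible.reach (h : T.IsFeasible c P L x) :
    Reach 0 x T.acts T.dur (T.path T.dur) := by
  have := h.reach_from le_rfl h.dur_nonneg (List.Sublist.refl _) fun p hp => (h.time_mem p hp).1
  rwa [h.path_zero] at this

theorem Reach.exists_tour (hX : IsGeodesic X) (h : Reach 0 x l D z)
    (hs : Serves c P L (l.map Prod.snd)) :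
    ∃ T : Tour X, T.IsFeasible c P L x ∧ T.dur = D ∧ T.path T.dur = z ∧ T.acts = l := by
  obtain ⟨f, h0, h1, hf, hl⟩ := h.exists_path hX
  refine ⟨⟨D, f, l⟩, ⟨?_, h0, hf.lipschitzOnWith, h.sorted, fun p hp => h.mem_Icc hp, hl, hs⟩,
    rfl, h1, rfl⟩
  simpa using dist_nonneg.trans h.dist_le

/-- Release times play no role here, so a timetable that starts at any time `t` competes with `T`
after a shift to time `0`. -/
theorem Tour.IsShortest.dur_le (hX : IsGeodesic X) (hT : T.IsShortest c R x)
    (h : Reach t x l D z) (hs : Serves c R ∅ (l.map Prod.snd)) : T.dur ≤ D - t := by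
  have := h.shift (-t)
  rw [add_neg_cancel] at this
  obtain ⟨T', hT', hd, -⟩ := this.exists_tour (c := c) (P := R) (L := ∅) hX (by rw [List.map_map]; exact hs)
  have := hT.2 T' hT'
  linarith

theorem Tour.IsShortestReturn.dur_le (hX : IsGeodesic X) (hT : T.IsShortestReturn c O x L)
    (h : Reach t x l D O) (hs : Serves c ∅ L (l.map Prod.snd)) : T.dur ≤ D - t := by
  have := h.shift (-t)
  rw [add_neg_cancel] at this
  obtain ⟨T', hT', hd, hO, -⟩ :=
    this.exists_tour (c := c) (P := ∅) (L := L) hX (by rw [List.map_map]; exact hs)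
  have := hT.2 T' hT' hO
  linarith

theorem Tour.stay_isFeasible (x : X) {s : ℝ} (hs : 0 ≤ s) :
    (Tour.stay x s).IsFeasible c ∅ ∅ x where
  dur_nonneg := hs
  path_zero := rfl
  speed := (LipschitzWith.const' x).lipschitzOnWith |>.weaken zero_le_one
  sorted := by simp [Tour.stay]
  time_mem := by simp [Tour.stay]
  path_time := by simp [Tour.stay]
  serves := ⟨rfl, rfl⟩

/-- The length of the route that starts at `x`, performs the actions `l` and ends at `z`. -/
def routeLength : X → List (Act X) → X → ℝ
  | x, [], z => dist x z
  | x, a :: l, z => dist x a.point + routeLength a.point l z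

/-- The position after performing the actions `l` from `x`. -/
def routeEnd : X → List (Act X) → X
  | x, [] => x
  | _, a :: l => routeEnd a.point l

theorem routeLength_routeEnd_le (x : X) (l : List (Act X)) (z : X) :
    routeLength x l (routeEnd x l) ≤ routeLength x l z := by
  induction l generalizing x with
  | nil => simp [routeLength, routeEnd]
  | cons a l ih => simpa [routeLength, routeEnd] using ih a.point

theorem Reach.routeLength_le (h : Reach t x l D z) : routeLength x (l.map Prod.snd) z ≤ D - t := by
  induction l generalizing t x with
  | nil => exact h
  | cons p l ih =>
    have h1 := h.1
    have h2 := ih h.2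
    simp only [List.map_cons, routeLength]
    linarith

theorem exists_reach (t : ℝ) (x : X) (l : List (Act X)) (z : X) :
    ∃ l' : List (ℝ × Act X), l'.map Prod.snd = l ∧ Reach t x l' (t + routeLength x l z) z := by
  induction l generalizing t x with
  | nil => exact ⟨[], rfl, by simp [Reach, routeLength]⟩
  | cons a l ih =>
    obtain ⟨l', hl', h⟩ := ih (t + dist x a.point) a.point
    refine ⟨(t + dist x a.point, a) :: l', by simp [hl'], by simp, ?_⟩
    simpa [routeLength, add_assoc] using h

/-- A tour is at least as long as the route through its actions, and only finitely many orders of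
actions are possible; the best route is realized by a tour. -/
theorem exists_isShortest (hX : IsGeodesic X) (hc : 1 ≤ c) (R : Finset (Request X)) (x : X) :
    ∃ T : Tour X, T.IsShortest c R x := by
  obtain ⟨l, hl, hmin⟩ := Set.exists_min_image {l : List (Act X) | Serves c R ∅ l}
    (fun l => routeLength x l (routeEnd x l)) (Serves.finite_setOf (Finset.disjoint_empty_right R))
    (Serves.exists_serves hc R)
  obtain ⟨l', rfl, h⟩ := exists_reach 0 x l (routeEnd x l)
  obtain ⟨T, hT, hd, -⟩ := h.exists_tour (c := c) (P := R) (L := ∅) hX hl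
  refine ⟨T, hT, fun T' hT' => ?_⟩
  have h1 := hmin _ hT'.serves
  have h2 := hT'.reach.routeLength_le
  have h3 := routeLength_routeEnd_le x (T'.acts.map Prod.snd) (T'.path T'.dur)
  linarith

theorem exists_isShortestReturn (hX : IsGeodesic X) (O x : X) (L : Finset (Request X)) :
    ∃ T : Tour X, T.IsShortestReturn c O x L := by
  obtain ⟨l, hl, hmin⟩ := Set.exists_min_image {l : List (Act X) | Serves c ∅ L l}
    (fun l => routeLength x l O) (Serves.finite_setOf (Finset.disjoint_empty_left L))
    (Serves.exists_unload L)
  obtain ⟨l', rfl, h⟩ := exists_reach 0 x l O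
  obtain ⟨T, hT, hd, hO, -⟩ := h.exists_tour (c := c) (P := ∅) (L := L) hX hl
  refine ⟨T, ⟨hT, hO⟩, fun T' hT' hO' => ?_⟩
  have h1 := hmin _ hT'.serves
  have h2 := hT'.reach.routeLength_le
  rw [hO'] at h2
  linarith

theorem nonempty_lazyRule (hX : IsGeodesic X) (hc : 1 ≤ c) (O : X) : Nonempty (LazyRule c O) := by
  choose S hS using exists_isShortest (c := c) hX hc
  choose B hB using exists_isShortestReturn (c := c) hX O
  exact ⟨⟨S, B, hS, hB⟩⟩

/-- The part of a feasible schedule that deals with the requests in `R`. -/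
theorem Tour.IsFeasible.serves_filter (h : T.IsFeasible c P ∅ x) (hR : R ⊆ P) :
    Serves c R ∅ ((T.acts.filter fun p => decide (p.2.req ∈ R)).map Prod.snd) := by
  have := h.serves.restrict R
  rw [Finset.inter_eq_right.2 hR, Finset.empty_inter, List.filter_map] at this
  exact this

theorem Tour.IsFeasible.exists_load_unload (h : T.IsFeasible c P ∅ x) {r : Request X}
    (hr : r ∈ P) : ∃ s u, (s, Act.load r) ∈ T.acts ∧ (u, Act.unload r) ∈ T.acts ∧
      Reach 0 x [(s, Act.load r), (u, Act.unload r)] T.dur (T.path T.dur) := by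
  have hs := (h.serves_filter (R := {r}) (by simpa using hr)).singleton
  obtain ⟨p, l, hp, hp1, hl⟩ := List.map_eq_cons_iff.1 hs
  obtain ⟨q, l, rfl, hq1, hl⟩ := List.map_eq_cons_iff.1 hl
  obtain rfl := List.map_eq_nil_iff.1 hl
  obtain ⟨s, a⟩ := p
  obtain ⟨u, b⟩ := q
  simp only at hp1 hq1
  subst hp1 hq1
  have hsub : [(s, Act.load r), (u, Act.unload r)].Sublist T.acts := by
    rw [← hp]; exact List.filter_sublist
  exact ⟨s, u, hsub.subset (by simp), hsub.subset (by simp), h.reach.sublist hsub⟩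

/-- A shortest schedule ends with unloading a request. -/
theorem Tour.IsShortest.exists_dst_eq (hT : T.IsShortest c R x) (hR : R.Nonempty) :
    ∃ q ∈ R, (T.dur, Act.unload q) ∈ T.acts ∧ T.path T.dur = q.dst := by
  obtain ⟨l, q, hq, hl⟩ := hT.1.serves.exists_eq_append_unload (by simpa using hR)
  obtain ⟨l₁, l₂, hl12, rfl, h2⟩ := List.map_eq_append_iff.1 hl
  obtain ⟨p, l₃, rfl, hp, h3⟩ := List.map_eq_cons_iff.1 h2
  obtain rfl := List.map_eq_nil_iff.1 h3
  have hpm : p ∈ T.acts := by simp [hl12]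
  have hlast : ∀ p' ∈ T.acts, p'.1 ≤ p.1 := by
    intro p' hp'
    have := hT.1.sorted
    rw [hl12, List.map_append, List.pairwise_append] at this
    rw [hl12, List.mem_append, List.mem_singleton] at hp'
    rcases hp' with h | rfl
    · exact this.2.2 _ (List.mem_map_of_mem h) _ (by simp)
    · exact le_rfl
  have hp1 := hT.1.time_mem p hpm
  -- Cutting the tour at its last action keeps it feasible, so by minimality it already ended there.
  have hfeas : (⟨p.1, T.path, T.acts⟩ : Tour X).IsFeasible c R ∅ x :=
    ⟨hp1.1, hT.1.path_zero, hT.1.speed.mono (Set.Icc_subset_Icc_right hp1.2), hT.1.sorted,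
      fun p' hp' => ⟨(hT.1.time_mem p' hp').1, hlast p' hp'⟩, hT.1.path_time, hT.1.serves⟩
  have hd : T.dur = p.1 := le_antisymm (hT.2 _ hfeas) hp1.2
  refine ⟨q, by simpa using hq, ?_, ?_⟩
  · rwa [hd, ← hp]
  · rw [hd, hT.1.path_time p hpm, hp]
    rfl

end Tour

/-! ### Bounds for the offline optimum -/

section Opt

variable [MetricSpace X] {P Q R : Finset (Request X)} {O x : X} {T : Tour X}

theorem opt_le (hT : T.IsFeasible c R ∅ O) (hr : T.RespectsRelease) : opt c O R ≤ T.dur :=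
  csInf_le ⟨0, by rintro _ ⟨T, hT, -, rfl⟩; exact hT.dur_nonneg⟩ ⟨T, hT, hr, rfl⟩

theorem opt_le_of_reach (hX : IsGeodesic X) {l : List (ℝ × Act X)} {D : ℝ} {z : X}
    (h : Reach 0 O l D z) (hs : Serves c R ∅ (l.map Prod.snd))
    (hr : ∀ s r, (s, Act.load r) ∈ l → r.rel ≤ s) : opt c O R ≤ D := by
  obtain ⟨T, hT, rfl, -, rfl⟩ := h.exists_tour (c := c) (P := R) (L := ∅) hX hs
  exact opt_le hT hr

/-- Waiting at `O` until everything is released is always possible. Hence `opt` is not the infimum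
of an empty set, which would be `0` by convention. -/
theorem exists_respectsRelease (hX : IsGeodesic X) (hc : 1 ≤ c) (O : X) (R : Finset (Request X)) :
    ∃ T : Tour X, T.IsFeasible c R ∅ O ∧ T.RespectsRelease := by
  obtain ⟨l, hl⟩ := Serves.exists_serves hc R
  obtain ⟨τ, hτ⟩ := (R.finite_toSet.image Request.rel).bddAbove
  obtain ⟨l', rfl, h⟩ := exists_reach (max 0 τ) O l O
  have h0 : Reach 0 O l' _ O := Reach.of_le (by simp) h
  obtain ⟨T, hT, -, -, rfl⟩ := h0.exists_tour (c := c) (P := R) (L := ∅) hX hl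
  refine ⟨T, hT, fun s r hr => ?_⟩
  have h1 := (h.mem_Icc hr).1
  have h2 : r ∈ R := (hl.load_mem_iff r).1 (List.mem_map_of_mem hr)
  exact (hτ ⟨r, h2, rfl⟩).trans ((le_max_right _ _).trans h1)

theorem le_opt (hX : IsGeodesic X) (hc : 1 ≤ c) {b : ℝ}
    (h : ∀ T : Tour X, T.IsFeasible c R ∅ O → T.RespectsRelease → b ≤ T.dur) : b ≤ opt c O R := by
  obtain ⟨T, hT, hr⟩ := exists_respectsRelease hX hc O R
  refine le_csInf ⟨_, T, hT, hr, rfl⟩ ?_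
  rintro _ ⟨T, hT, hr, rfl⟩
  exact h T hT hr

theorem opt_nonneg (c : ℕ∞) (O : X) (R : Finset (Request X)) : 0 ≤ opt c O R :=
  Real.sInf_nonneg (by rintro _ ⟨T, hT, -, rfl⟩; exact hT.dur_nonneg)

theorem opt_mono (hX : IsGeodesic X) (hc : 1 ≤ c) (h : R ⊆ P) : opt c O R ≤ opt c O P := by
  refine le_opt hX hc fun T hT hr => ?_
  refine opt_le_of_reach hX (hT.reach.sublist List.filter_sublist) (hT.serves_filter h) ?_
  intro s r hs
  exact hr s r (List.mem_of_mem_filter hs)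

theorem rel_le_opt (hX : IsGeodesic X) (hc : 1 ≤ c) {r : Request X} (h : r ∈ R) :
    r.rel ≤ opt c O R := by
  refine le_opt hX hc fun T hT hr => ?_
  obtain ⟨s, u, hs, -⟩ := hT.exists_load_unload h
  exact (hr s r hs).trans (hT.time_mem _ hs).2

theorem dist_dst_le_opt (hX : IsGeodesic X) (hc : 1 ≤ c) {r : Request X} (h : r ∈ R) :
    dist O r.dst ≤ opt c O R := by
  refine le_opt hX hc fun T hT hr => ?_
  obtain ⟨s, u, -, hu, -⟩ := hT.exists_load_unload h
  have h1 := (hT.reach.of_mem hu).1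
  have h2 := (hT.time_mem _ hu).2
  simp only [Act.point] at h1 h2
  linarith

theorem Tour.IsShortest.dur_le_opt (hX : IsGeodesic X) (hc : 1 ≤ c) (hT : T.IsShortest c R O)
    (h : R ⊆ P) : T.dur ≤ opt c O P := by
  refine le_opt hX hc fun T' hT' _ => ?_
  simpa using hT.dur_le hX (hT'.reach.sublist List.filter_sublist) (hT'.serves_filter h)

/-- A shortest schedule for requests that are released after time `τ`, starting at the destination
of any request, takes no longer than `opt` if `opt < 2 * τ`. -/
theorem Tour.IsShortest.dur_le_opt_of_lt (hX : IsGeodesic X) (hc : 1 ≤ c) (hT : T.IsShortest c R x)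
    (h : R ⊆ P) (hR : R.Nonempty) {q : Request X} (hq : q ∈ P) (hqx : q.dst = x) {τ : ℝ}
    (hτ : ∀ r ∈ R, τ ≤ r.rel) (hlt : opt c O P < 2 * τ) : T.dur ≤ opt c O P := by
  -- Instead of an optimal tour, one of duration below both `b` and `2 * τ` is used; attainment of
  -- the infimum is never needed.
  refine le_of_forall_gt_imp_ge_of_dense fun b hb => ?_
  have hne : {s | ∃ T : Tour X, T.IsFeasible c P ∅ O ∧ T.RespectsRelease ∧ T.dur = s}.Nonempty := by
    obtain ⟨T, hT, hr⟩ := exists_respectsRelease hX hc O P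
    exact ⟨_, T, hT, hr, rfl⟩
  obtain ⟨_, ⟨T', hT', hr', rfl⟩, hlt'⟩ := exists_lt_of_csInf_lt hne (lt_min hb hlt)
  have hb' := hlt'.le.trans (min_le_left _ _)
  have hτ' := hlt'.trans_le (min_le_right _ _)
  refine le_trans ?_ hb'
  obtain ⟨_, u, -, hu, -⟩ := hT'.exists_load_unload hq
  have hs := hT'.serves_filter h
  have hsub : (T'.acts.filter fun p => decide (p.2.req ∈ R)).Sublist T'.acts :=
    List.filter_sublist
  revert hs hsub
  generalize T'.acts.filter (fun p => decide (p.2.req ∈ R)) = l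
  intro hs hsub
  match l, hs with
  | [], hs => exact absurd hs.1 hR.ne_empty
  | (s, Act.unload r) :: l, hs => simp [Serves] at hs
  | (s, Act.load r) :: l, hs =>
    have hr : r ∈ R := hs.1
    have hsm : (s, Act.load r) ∈ T'.acts := hsub.subset (by simp)
    have hτs : τ ≤ s := (hτ r hr).trans (hr' s r hsm)
    have hum := hT'.time_mem _ hu
    have hsm' := hT'.time_mem _ hsm
    have hup := hT'.path_time _ hu
    have hsp := hT'.path_time _ hsm
    have hd := hT'.speed.dist_le_mul _ hum _ hsm'
    simp only [hup, hsp, Act.point, NNReal.coe_one, one_mul, hqx, Real.dist_eq] at hd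
    have hreach := hT'.reach.sublist hsub
    simp only [Set.mem_Icc] at hum hsm'
    rcases le_total u s with hus | hus
    -- The tour visits `x` before it first loads a request of `R`: its remainder from time `u`
    -- suffices.
    · rw [abs_sub_comm, abs_of_nonneg (by linarith)] at hd
      have := hT.dur_le hX (t := u) (l := (s, Act.load r) :: l) ⟨hd, hreach.2⟩ hs
      linarith
    -- The tour visits `x` later, at time `u`, so `x` is within `u - s` of `r.src`. Going there and
    -- following the tour from time `s` costs at most 2(`T'.dur` - `s`) ≤ 2(`T'.dur` - `τ`) <
    -- `T'.dur`.
    · rw [abs_of_nonneg (by linarith)] at hd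
      have := hT.dur_le hX (t := s - dist x r.src) (l := (s, Act.load r) :: l)
        ⟨by simp [Act.point], hreach.2⟩ hs
      linarith

end Opt

end DialARide

/-! ### The state of the server during a command -/

namespace DialARide

universe u

variable {X : Type u} {c : ℕ∞}

theorem filter_append_filter_of_sorted {β : Type*} (l : List (ℝ × β)) (s : ℝ)
    (h : (l.map Prod.fst).Pairwise (· ≤ ·)) :
    (l.filter fun p => decide (p.1 ≤ s)) ++ (l.filter fun p => decide (s < p.1)) = l := by
  induction l with
  | nil => rfl
  | cons p l ih =>
    rw [List.map_cons, List.pairwise_cons] at h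
    by_cases hp : p.1 ≤ s
    · simpa [hp, hp.not_gt] using ih h.2
    · have hall : ∀ q ∈ l, s < q.1 := fun q hq =>
        (not_le.1 hp).trans_le (h.1 _ (List.mem_map_of_mem hq))
      have h1 : l.filter (fun p => decide (p.1 ≤ s)) = [] := by
        simpa [List.filter_eq_nil_iff] using fun a b hab => hall _ hab
      have h2 : l.filter (fun p => decide (s < p.1)) = l := by
        simpa [List.filter_eq_self] using fun a b hab => hall _ hab
      simp [hp, not_le.1 hp, h1, h2]

namespace Config

variable {C : Config X}

theorem executed_eq (C : Config X) (t : ℝ) : C.executed t =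
    (C.tour.acts.filter fun p => decide (p.1 ≤ t - C.start)).map Prod.snd := by
  simp only [executed, le_sub_iff_add_le']

theorem posAt_finish (C : Config X) : C.posAt C.finish = C.tour.path C.tour.dur := by
  simp [posAt, finish]

/-- Bookkeeping about the requests of the sequence `σ`. -/
structure Tracks (C : Config X) (σ : List (Request X)) : Prop where
  known_union : C.known ∪ C.future.toFinset = σ.toFinset
  pairwise : C.future.Pairwise fun r r' => r.rel < r'.rel
  start_le : ∀ r ∈ C.future, C.start ≤ r.rel
  waiting_subset : C.waiting ⊆ C.known

theorem Tracks.reveal {σ : List (Request X)} (h : C.Tracks σ) {r : Request X}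
    {rest : List (Request X)} (hf : C.future = r :: rest) : (C.reveal r rest).Tracks σ := by
  obtain ⟨h1, h2, h3, h4⟩ := h
  rw [hf] at h1 h2 h3
  refine ⟨?_, (List.pairwise_cons.1 h2).2, fun q hq => h3 q (List.mem_cons_of_mem _ hq),
    Finset.insert_subset_insert _ h4⟩
  rw [← h1]
  ext q
  simp [Config.reveal]

theorem Tracks.execute {σ : List (Request X)} {t : ℝ} (h : C.Tracks σ) (ht : ∀ r ∈ C.future, t ≤ r.rel)
    (T : Tour X) : (C.execute t T).Tracks σ :=
  ⟨h.known_union, h.pairwise, ht, (Finset.filter_subset _ _).trans h.waiting_subset⟩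

end Config

section

variable [MetricSpace X] {O : X} {C : Config X} {P : Finset (Request X)} {t : ℝ}

/-- The current command of `C` collects exactly the waiting requests in `P`, and delivers them
together with the loaded requests. -/
structure Config.Runs (c : ℕ∞) (C : Config X) (P : Finset (Request X)) : Prop where
  feasible : C.tour.IsFeasible c P C.loaded (C.tour.path 0)
  subset : P ⊆ C.waiting
  disjoint : Disjoint P C.loaded

namespace Config

namespace Runs

theorem start_le_finish (h : C.Runs c P) : C.start ≤ C.finish := by
  have := h.feasible.dur_nonneg
  simp only [finish]
  linarith

theorem load_mem_executed (h : C.Runs c P) {r : Request X} (hr : Act.load r ∈ C.executed t) :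
    r ∈ P := by
  rw [executed_eq] at hr
  exact (h.feasible.serves.load_mem_iff r).1 ((List.filter_sublist.map _).subset hr)

theorem loadedAt_eq (h : C.Runs c P) (t : ℝ) : C.loadedAt t =
    (C.loaded ∪ P.filter fun r => Act.load r ∈ C.executed t).filter
      fun r => Act.unload r ∉ C.executed t := by
  ext r
  have h1 := @load_mem_executed _ _ _ _ _ t h r
  have h2 := @h.subset r
  simp only [loadedAt, Finset.mem_filter, Finset.mem_union]
  tauto

theorem executed_finish (h : C.Runs c P) : C.executed C.finish = C.tour.acts.map Prod.snd := by
  rw [executed_eq, List.filter_eq_self.2]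
  intro p hp
  simpa [finish] using (h.feasible.time_mem p hp).2

theorem waitingAt_finish (h : C.Runs c P) : C.waitingAt C.finish = C.waiting \ P := by
  ext r
  simp only [waitingAt, h.executed_finish, h.feasible.serves.load_mem_iff, Finset.mem_filter,
    Finset.mem_sdiff]

theorem loadedAt_finish (h : C.Runs c P) : C.loadedAt C.finish = ∅ := by
  rw [h.loadedAt_eq, h.executed_finish, Finset.filter_eq_empty_iff]
  intro r hr
  rw [not_not]
  refine h.feasible.serves.unload_mem ?_
  simp only [Finset.mem_union, Finset.mem_filter] at hr ⊢
  tauto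

theorem reveal (h : C.Runs c P) (r : Request X) (rest : List (Request X)) :
    (C.reveal r rest).Runs c P :=
  ⟨h.feasible, h.subset.trans (Finset.subset_insert _ _), h.disjoint⟩

/-- Completing the current command and going to the origin is one way to deliver the loaded
requests and to return. -/
theorem ret_dur_le (hX : IsGeodesic X) (A : LazyRule c O) (h : C.Runs c P) (h1 : C.start ≤ t)
    (h2 : t ≤ C.finish) :
    (A.ret (C.posAt t) (C.loadedAt t)).dur ≤ C.finish - t + dist (C.posAt C.finish) O := by
  have hsplit := filter_append_filter_of_sorted C.tour.acts (t - C.start) h.feasible.sorted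
  have hs := h.feasible.serves
  rw [← hsplit, List.map_append, ← executed_eq] at hs
  -- The actions still to come serve all that remains; restricted to the loaded requests, they no
  -- longer collect anything.
  have hs' := (hs.of_append h.disjoint).restrict (C.loadedAt t)
  rw [← h.loadedAt_eq, Finset.inter_self, List.filter_map,
    Finset.disjoint_iff_inter_eq_empty.1] at hs'
  · have hsub : ((C.tour.acts.filter fun p => decide (t - C.start < p.1)).filter
        fun p => decide (p.2.req ∈ C.loadedAt t)).Sublist C.tour.acts :=
      List.filter_sublist.trans List.filter_sublist
    have hR := h.feasible.reach_from (s := t - C.start) (by linarith)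
      (by simp only [finish] at h2; linarith) hsub (by
        intro p hp
        have := List.of_mem_filter (List.mem_of_mem_filter hp)
        exact (of_decide_eq_true this).le)
    have hR' := hR.extend (w := O) (D' := C.tour.dur + dist (C.tour.path C.tour.dur) O) (by simp)
    have := (A.ret_shortest (C.posAt t) (C.loadedAt t)).dur_le hX hR' hs'
    rw [posAt_finish]
    simp only [finish]
    linarith
  · rw [h.loadedAt_eq, Finset.disjoint_left]
    intro r hr hr'
    have hd := Finset.disjoint_left.1 h.disjoint
    simp only [Finset.mem_filter, Finset.mem_union] at hr hr'
    rcases hr'.1 with h' | h'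
    · exact hd hr.1 h'
    · exact hr.2 h'.2

end Runs

theorem runs_ret (A : LazyRule c O) (C : Config X) (t : ℝ) (x : X) :
    (C.execute t (A.ret x (C.loadedAt t))).Runs c ∅ where
  feasible := by
    have := (A.ret_shortest x (C.loadedAt t)).1.1
    simpa only [execute, this.path_zero] using this
  subset := by simp
  disjoint := by simp

theorem runs_stay {C : Config X} {t : ℝ} (h : C.loadedAt t = ∅) (x : X) {s : ℝ} (hs : 0 ≤ s) :
    (C.execute t (Tour.stay x s)).Runs c ∅ where
  feasible := by
    simp only [execute, h]
    exact Tour.stay_isFeasible x hs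
  subset := by simp
  disjoint := by simp

theorem runs_sched (A : LazyRule c O) {C : Config X} {t : ℝ} (h : C.loadedAt t = ∅) (x : X) :
    (C.execute t (A.sched (C.waitingAt t) x)).Runs c (C.waitingAt t) where
  feasible := by
    have := (A.sched_shortest (C.waitingAt t) x).1
    simpa only [execute, h, this.path_zero] using this
  subset := by simp [execute]
  disjoint := by simp [execute, h]

/-! ### The invariant and its preservation when a request arrives -/

/-- The end of the current command lies within `α * opt`, or the server is idle until the next
request is released. -/
def InTime (c : ℕ∞) (O : X) (α : ℝ) (C : Config X) : Prop :=
  C.finish ≤ α * opt c O C.known ∨ ∃ r rest, C.future = r :: rest ∧ C.finish = r.rel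

/-- The current command brings the empty server to the origin. -/
structure IsHome (c : ℕ∞) (O : X) (α : ℝ) (C : Config X) : Prop where
  runs : C.Runs c ∅
  pos : C.posAt C.finish = O
  inTime : C.InTime c O α

/-- The server follows a shortest schedule for the requests `P` or has finished such a schedule
and waits. This schedule was started when the optimum was `Q`. -/
structure IsAway (c : ℕ∞) (O : X) (α : ℝ) (C : Config X) (P : Finset (Request X)) (Q : ℝ) :
    Prop where
  runs : C.Runs c P
  pos : 0 < Q
  le_opt : Q ≤ opt c O C.known
  le_start : α * Q ≤ C.start
  dist_le : dist (C.posAt C.finish) O ≤ Q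
  dst : ∃ q ∈ C.known, q.dst = C.posAt C.finish
  rel_le : ∀ r ∈ C.waiting \ P, α * Q ≤ r.rel
  opt_lt : (C.waiting \ P).Nonempty → opt c O C.known < 2 * (α * Q)
  phase : C.finish ≤ (1 + α) * Q ∨
    ((∀ t, C.posAt t = C.posAt C.finish) ∧ (∀ t, C.loadedAt t = ∅) ∧ C.InTime c O α)

/-- The configurations that `Lazy` goes through. -/
def IsReachable (c : ℕ∞) (O : X) (α : ℝ) (σ : List (Request X)) (C : Config X) : Prop :=
  C.Tracks σ ∧ (C.IsHome c O α ∨ ∃ P Q, C.IsAway c O α P Q)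

/-- All requests are served when the current command ends, and this is not too late. -/
def IsFinal (c : ℕ∞) (O : X) (α : ℝ) (C : Config X) : Prop :=
  C.future = [] ∧ C.start ≤ C.finish ∧ C.waitingAt C.finish = ∅ ∧ C.loadedAt C.finish = ∅ ∧
    C.finish ≤ (1 + α) * opt c O C.known

theorem IsHome.ret (A : LazyRule c O) {α : ℝ}
    (h : t + (A.ret (C.posAt t) (C.loadedAt t)).dur ≤ α * opt c O C.known) :
    (C.execute t (A.ret (C.posAt t) (C.loadedAt t))).IsHome c O α where
  runs := runs_ret A C t _
  pos := by
    rw [posAt_finish]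
    exact (A.ret_shortest _ _).1.2
  inTime := Or.inl h

/-- Receiving a request. -/
theorem IsReachable.receive (hX : IsGeodesic X) (hc : 1 ≤ c) (A : LazyRule c O) {α : ℝ}
    (hα : 1 ≤ α) (hα2 : α ^ 2 = α + 1) {σ : List (Request X)} (h : C.IsReachable c O α σ)
    {r : Request X} {rest : List (Request X)} (hf : C.future = r :: rest)
    (hr : r.rel ≤ C.finish) : (C.receive A α r rest).IsReachable c O α σ := by
  obtain ⟨htr, hmode⟩ := h
  have htr' := htr.reveal hf
  have hstart : C.start ≤ r.rel := htr.start_le r (by simp [hf])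
  have hrest : ∀ q ∈ rest, r.rel ≤ q.rel := by
    have := htr.pairwise
    rw [hf, List.pairwise_cons] at this
    exact fun q hq => (this.1 q hq).le
  have hrel : r.rel ≤ opt c O (insert r C.known) := rel_le_opt hX hc (Finset.mem_insert_self _ _)
  have hmono : opt c O C.known ≤ opt c O (insert r C.known) :=
    opt_mono hX hc (Finset.subset_insert _ _)
  have hopt0 := opt_nonneg c O (insert r C.known)
  -- An idle period ends at `r.rel`, which is at most the new optimum.
  have htime : C.InTime c O α → C.finish ≤ α * opt c O (insert r C.known) := by
    rintro (h | ⟨q, l, hq, h⟩)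
    · nlinarith
    · rw [hf, List.cons.injEq] at hq
      rw [← hq.1] at h
      nlinarith
  simp only [Config.receive]
  set C' := C.reveal r rest with hC'
  have hfin : C'.finish = C.finish := rfl
  have hpos : ∀ t, C'.posAt t = C.posAt t := fun _ => rfl
  split_ifs with hret
  · exact ⟨htr'.execute hrest _, Or.inl (IsHome.ret A hret)⟩
  · refine ⟨htr', Or.inr ?_⟩
    rw [not_le] at hret
    change α * opt c O (insert r C.known) < _ at hret
    rcases hmode with hh | ⟨P, Q, ha⟩
    · exfalso
      have h1 := (hh.runs.reveal r rest).ret_dur_le hX A hstart hr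
      rw [← hC', hfin, hpos C.finish, hh.pos, dist_self] at h1
      have h2 := htime hh.inTime
      linarith
    · have hruns := ha.runs.reveal r rest
      rw [← hC'] at hruns
      have hQ := ha.pos
      refine ⟨P, Q, hruns, ha.pos, ha.le_opt.trans hmono, ha.le_start, ha.dist_le, ?_, ?_, ?_, ?_⟩
      · obtain ⟨q, hq, hq'⟩ := ha.dst
        exact ⟨q, Finset.mem_insert_of_mem hq, hq'⟩
      · intro q hq
        simp only [hC', Config.reveal, Finset.mem_sdiff, Finset.mem_insert] at hq
        rcases hq with ⟨rfl | hq, hqP⟩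
        · exact ha.le_start.trans hstart
        · exact ha.rel_le q (by simp [hq, hqP])
      · intro _
        change opt c O (insert r C.known) < _
        -- If the schedule is running, finishing it and going home ends by (2 + α)`Q`, so the
        -- refusal gives α·opt < (2 + α)`Q` ≤ 2α²`Q`. If the server rests, the way home takes at
        -- most `Q`, so (α - 1)·opt < `Q`, that is, opt < α`Q`, because α(α - 1) = 1.
        rcases ha.phase with hp | ⟨hp, hl, -⟩
        · have h1 := hruns.ret_dur_le hX A hstart hr
          rw [hfin, hpos C.finish] at h1
          have h2 := ha.dist_le
          nlinarith
        · have h1 := ((A.ret_shortest (C'.posAt r.rel) ∅).dur_le hX (t := 0) (l := [])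
            (D := dist (C'.posAt r.rel) O) (by simp [Reach]) ⟨rfl, rfl⟩)
          have h3 : C'.loadedAt r.rel = ∅ := by
            have h4 := hl r.rel
            rw [hruns.loadedAt_eq]
            rwa [ha.runs.loadedAt_eq] at h4
          rw [← h3, hpos, hp] at h1
          rw [hpos, hp] at hret
          have h2 := ha.dist_le
          nlinarith
      · rcases ha.phase with hp | ⟨hp, hl, ht⟩
        · exact Or.inl hp
        · refine Or.inr ⟨hp, fun t => ?_, Or.inl (htime ht)⟩
          have h4 := hl t
          rw [hruns.loadedAt_eq]
          rwa [ha.runs.loadedAt_eq] at h4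

end Config

end

end DialARide

/-! ### Termination and the upper bound -/

namespace DialARide

universe u

variable {X : Type u} {c : ℕ∞} [MetricSpace X] {O : X} {C : Config X}

namespace Config

/-- This decreases with every event. -/
noncomputable def rank (c : ℕ∞) (O : X) (α : ℝ) (C : Config X) : ℕ ×ₗ ℕ ×ₗ ℕ :=
  open Classical in
  toLex (C.future.length, toLex ((C.waitingAt C.finish).card,
    if C.finish < α * opt c O C.known then 2 else if ∃ r ∈ C.future, r.rel ≤ C.finish then 0
    else 1))

theorem IsHome.stay {α t s : ℝ} (hl : C.loadedAt t = ∅) (hs : 0 ≤ s)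
    (ht : (C.execute t (Tour.stay O s)).InTime c O α) :
    (C.execute t (Tour.stay O s)).IsHome c O α :=
  ⟨runs_stay hl O hs, rfl, ht⟩

theorem IsAway.stay {α s Q : ℝ} {P : Finset (Request X)} (h : C.IsAway c O α P Q) (hs : 0 ≤ s)
    (ht : (C.execute C.finish (Tour.stay (C.posAt C.finish) s)).InTime c O α) :
    (C.execute C.finish (Tour.stay (C.posAt C.finish) s)).IsAway c O α ∅ Q where
  runs := runs_stay h.runs.loadedAt_finish _ hs
  pos := h.pos
  le_opt := h.le_opt
  le_start := h.le_start.trans h.runs.start_le_finish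
  dist_le := h.dist_le
  dst := h.dst
  rel_le := by
    simp only [execute, h.runs.waitingAt_finish, Finset.sdiff_empty]
    exact h.rel_le
  opt_lt := by
    simp only [execute, h.runs.waitingAt_finish, Finset.sdiff_empty]
    exact h.opt_lt
  phase := by
    refine Or.inr ⟨fun _ => rfl, fun t => ?_, ht⟩
    rw [(runs_stay (c := c) h.runs.loadedAt_finish (C.posAt C.finish) hs).loadedAt_eq]
    simp [execute, h.runs.loadedAt_finish]

theorem IsAway.sched (hX : IsGeodesic X) (hc : 1 ≤ c) (A : LazyRule c O) {α t : ℝ} {x : X}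
    (hl : C.loadedAt t = ∅) (hne : (C.waitingAt t).Nonempty) (hw : C.waitingAt t ⊆ C.known)
    (hpos : ∀ r ∈ C.known, 0 < r.rel) (ht : t = α * opt c O C.known)
    (hd : (A.sched (C.waitingAt t) x).dur ≤ opt c O C.known) :
    (C.execute t (A.sched (C.waitingAt t) x)).IsAway c O α (C.waitingAt t)
      (opt c O C.known) := by
  obtain ⟨q, hq, -, hq'⟩ := (A.sched_shortest (C.waitingAt t) x).exists_dst_eq hne
  refine ⟨runs_sched A hl x, (hpos q (hw hq)).trans_le (rel_le_opt hX hc (hw hq)), le_rfl, ht.ge,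
    ?_, ⟨q, hw hq, ?_⟩, ?_, ?_, Or.inl ?_⟩
  · rw [posAt_finish, dist_comm]
    change dist O ((A.sched (C.waitingAt t) x).path (A.sched (C.waitingAt t) x).dur) ≤ _
    rw [hq']
    exact dist_dst_le_opt hX hc (hw hq)
  · rw [posAt_finish]
    exact hq'.symm
  · simp [execute]
  · simp [execute]
  · change t + (A.sched (C.waitingAt t) x).dur ≤ _
    linarith

/-- What holds when a command is completed and no request is received. -/
theorem IsReachable.at_finish (hX : IsGeodesic X) (hc : 1 ≤ c) (A : LazyRule c O) {α : ℝ}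
    (hα : 1 ≤ α) (hα2 : α ^ 2 = α + 1) {σ : List (Request X)} (h : C.IsReachable c O α σ)
    (hf : ∀ r ∈ C.future, C.finish < r.rel) :
    C.start ≤ C.finish ∧ C.loadedAt C.finish = ∅ ∧
    ((C.waitingAt C.finish).Nonempty → C.finish ≤ α * opt c O C.known ∧
      (A.sched (C.waitingAt C.finish) (C.posAt C.finish)).dur ≤ opt c O C.known) ∧
    C.finish ≤ (1 + α) * opt c O C.known ∧
    ∀ s, 0 ≤ s → (C.execute C.finish (Tour.stay (C.posAt C.finish) s)).InTime c O α →
      (C.execute C.finish (Tour.stay (C.posAt C.finish) s)).IsReachable c O α σ := by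
  obtain ⟨htr, hmode⟩ := h
  have hw : C.waitingAt C.finish ⊆ C.known := (Finset.filter_subset _ _).trans htr.waiting_subset
  have hopt0 := opt_nonneg c O C.known
  have htime : C.InTime c O α → C.finish ≤ α * opt c O C.known := by
    rintro (h | ⟨q, l, hq, h⟩)
    · exact h
    · exact absurd h (hf q (by simp [hq])).ne
  have hf' := fun r hr => (hf r hr).le
  rcases hmode with hh | ⟨P, Q, ha⟩
  · have ht := htime hh.inTime
    refine ⟨hh.runs.start_le_finish, hh.runs.loadedAt_finish, fun _ => ⟨ht, ?_⟩, by linarith,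
      fun s hs hs' => ⟨htr.execute hf' _, Or.inl ?_⟩⟩
    · rw [hh.pos]
      exact (A.sched_shortest _ O).dur_le_opt hX hc hw
    · rw [hh.pos] at hs' ⊢
      exact IsHome.stay hh.runs.loadedAt_finish hs hs'
  · have hQ := ha.le_opt
    have hQ0 := ha.pos
    refine ⟨ha.runs.start_le_finish, ha.runs.loadedAt_finish, fun hne => ⟨?_, ?_⟩, ?_,
      fun s hs hs' => ⟨htr.execute hf' _, Or.inr ⟨∅, Q, ha.stay hs hs'⟩⟩⟩
    -- A waiting request was released at `α * Q` or later, so (1 + α)`Q` = α²`Q` ≤ α·`r.rel` ≤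
    -- α·opt.
    · rcases ha.phase with hp | ⟨-, -, hp⟩
      · obtain ⟨r, hr⟩ := hne
        have h1 := rel_le_opt (O := O) hX hc (hw hr)
        rw [ha.runs.waitingAt_finish] at hr
        have h2 := ha.rel_le r hr
        nlinarith
      · exact htime hp
    -- The server stands at a destination that the optimum has to visit too, and the optimum is
    -- below twice `α * Q`.
    · obtain ⟨q, hq, hq'⟩ := ha.dst
      refine (A.sched_shortest _ _).dur_le_opt_of_lt hX hc hw hne hq hq' (τ := α * Q) ?_ ?_
      · rw [ha.runs.waitingAt_finish]
        exact ha.rel_le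
      · rw [ha.runs.waitingAt_finish] at hne
        exact ha.opt_lt hne
    · rcases ha.phase with hp | ⟨-, -, hp⟩
      · nlinarith
      · linarith [htime hp]

/-- Why `rank` drops: a release shortens `future`; a schedule leaves nothing waiting at its end;
waiting until `α * opt` takes the last entry from 2 to 1 or 0; idling until the next release takes
it from 1 to 0. -/
theorem IsReachable.next (hX : IsGeodesic X) (hc : 1 ≤ c) (A : LazyRule c O) {α : ℝ}
    (hα : 1 ≤ α) (hα2 : α ^ 2 = α + 1) {σ : List (Request X)} (hσ : ∀ r ∈ σ, 0 < r.rel)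
    (h : C.IsReachable c O α σ) : C.IsFinal c O α ∨
      ((C.next A α).IsReachable c O α σ ∧ (C.next A α).rank c O α < C.rank c O α) := by
  by_cases hf : ∃ r rest, C.future = r :: rest ∧ r.rel ≤ C.finish
  · obtain ⟨r, rest, hf, hr⟩ := hf
    have hnext : C.next A α = C.receive A α r rest := by
      simp only [Config.next, hf, if_pos hr]
    rw [hnext]
    refine Or.inr ⟨h.receive hX hc A hα hα2 hf hr, ?_⟩
    have : (C.receive A α r rest).future = rest := by
      simp only [Config.receive]
      split_ifs <;> rfl
    rw [rank, rank, Prod.Lex.toLex_lt_toLex]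
    left
    simp [this, hf]
  · have hf' : ∀ r ∈ C.future, C.finish < r.rel := by
      have hp := h.1.pairwise
      cases hF : C.future with
      | nil => simp
      | cons q l =>
        rw [hF, List.pairwise_cons] at hp
        have hq : C.finish < q.rel := by
          by_contra hq
          exact hf ⟨q, l, hF, not_lt.1 hq⟩
        intro r hr
        rcases List.mem_cons.1 hr with rfl | hr
        · exact hq
        · exact hq.trans (hp.1 r hr)
    have hnext : C.next A α = C.becomeIdle A α := by
      unfold Config.next
      split
      · rfl
      · rename_i r l hF
        rw [if_neg (not_le.2 (hf' r (by simp [hF])))]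
    rw [hnext]
    obtain ⟨hs, hl, hne, hfin, hstay⟩ := h.at_finish hX hc A hα hα2 hf'
    have hw : C.waitingAt C.finish ⊆ C.known :=
      (Finset.filter_subset _ _).trans h.1.waiting_subset
    have hwait : ∀ s, 0 ≤ s → (C.execute C.finish (Tour.stay (C.posAt C.finish) s)).waitingAt
        (C.execute C.finish (Tour.stay (C.posAt C.finish) s)).finish = C.waitingAt C.finish := by
      intro s hs
      rw [(runs_stay (c := c) hl _ hs).waitingAt_finish]
      simp [execute]
    simp only [becomeIdle]
    split_ifs with h1 h2
    · have hs' : 0 ≤ α * opt c O C.known - C.finish := by linarith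
      refine Or.inr ⟨hstay _ hs' (Or.inl ?_), ?_⟩
      · simp [execute, finish, Tour.stay]
      · have hnlt : ¬ (C.execute C.finish (Tour.stay (C.posAt C.finish)
            (α * opt c O C.known - C.finish))).finish < α * opt c O C.known := by
          simp [execute, finish, Tour.stay]
        rw [rank, rank, hwait _ hs', Prod.Lex.toLex_lt_toLex]
        refine Or.inr ⟨rfl, ?_⟩
        rw [Prod.Lex.toLex_lt_toLex]
        refine Or.inr ⟨rfl, ?_⟩
        simp only [if_pos h1]
        rw [if_neg (by exact hnlt)]
        split_ifs <;> simp
    · obtain ⟨h3, h4⟩ := hne h2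
      have hpos : ∀ r ∈ C.known, 0 < r.rel := by
        intro r hr
        refine hσ r ?_
        rw [← List.mem_toFinset, ← h.1.known_union]
        simp [hr]
      -- The server is neither late (`h3`) nor early (`h1`): the schedule starts exactly at `α *
      -- opt`.
      refine Or.inr ⟨⟨h.1.execute (fun r hr => (hf' r hr).le) _, Or.inr ⟨_, _,
        IsAway.sched hX hc A hl h2 hw hpos (le_antisymm h3 (not_lt.1 h1)) h4⟩⟩, ?_⟩
      rw [rank, rank, Prod.Lex.toLex_lt_toLex]
      refine Or.inr ⟨rfl, ?_⟩
      rw [Prod.Lex.toLex_lt_toLex]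
      left
      rw [(runs_sched A hl _).waitingAt_finish]
      simpa [execute] using h2
    · rw [Finset.not_nonempty_iff_eq_empty] at h2
      split
      · rename_i hF
        exact Or.inl ⟨hF, hs, h2, hl, hfin⟩
      · rename_i r l hF
        have hr := hf' r (by simp [hF])
        have hs' : 0 ≤ r.rel - C.finish := by linarith
        have hfin' : (C.execute C.finish (Tour.stay (C.posAt C.finish)
            (r.rel - C.finish))).finish = r.rel := by
          simp [execute, finish, Tour.stay]
        refine Or.inr ⟨hstay _ hs' (Or.inr ⟨r, l, hF, hfin'⟩), ?_⟩
        rw [rank, rank, hwait _ hs', Prod.Lex.toLex_lt_toLex]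
        refine Or.inr ⟨rfl, ?_⟩
        rw [Prod.Lex.toLex_lt_toLex]
        refine Or.inr ⟨rfl, ?_⟩
        rw [hfin']
        have h3 : ¬ ∃ r ∈ C.future, r.rel ≤ C.finish := by
          rintro ⟨q, hq, hq'⟩
          exact absurd hq' (hf' q hq).not_ge
        have h4 : ¬ r.rel < α * opt c O C.known := by linarith
        have h5 : ∃ q ∈ C.future, q.rel ≤ r.rel := ⟨r, by simp [hF], le_rfl⟩
        rw [if_neg (by exact h4), if_pos (by exact h5), if_neg h1, if_neg h3]
        exact Nat.zero_lt_one

theorem IsReachable.exists_isFinal (hX : IsGeodesic X) (hc : 1 ≤ c) (A : LazyRule c O) {α : ℝ}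
    (hα : 1 ≤ α) (hα2 : α ^ 2 = α + 1) {σ : List (Request X)} (hσ : ∀ r ∈ σ, 0 < r.rel)
    (h : C.IsReachable c O α σ) :
    ∃ m, ((Config.next A α)^[m] C).IsFinal c O α ∧ ((Config.next A α)^[m] C).Tracks σ := by
  induction hk : C.rank c O α using WellFoundedLT.induction generalizing C with
  | ind k ih =>
    rcases h.next hX hc A hα hα2 hσ with hfin | ⟨h', hlt⟩
    · exact ⟨0, hfin, h.1⟩
    · obtain ⟨m, hm⟩ := ih _ (hk ▸ hlt) h' rfl
      exact ⟨m + 1, hm⟩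

theorem isReachable_init (c : ℕ∞) (O : X) {α : ℝ} (hα : 1 ≤ α) {σ : List (Request X)}
    (hσ : ∀ r ∈ σ, 0 < r.rel) (hp : σ.Pairwise fun r r' => r.rel < r'.rel) :
    (init O σ).IsReachable c O α σ := by
  refine ⟨⟨by simp [init], hp, fun r hr => (hσ r hr).le, by simp [init]⟩, Or.inl ⟨⟨?_, ?_, ?_⟩, rfl,
    Or.inl ?_⟩⟩
  · exact Tour.stay_isFeasible O le_rfl
  · simp
  · simp
  · have := opt_nonneg c O (init O σ).known
    simp only [finish, init, Tour.stay] at this ⊢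
    nlinarith

end Config

theorem lazyTime_le (hX : IsGeodesic X) (hc : 1 ≤ c) (A : LazyRule c O) {α : ℝ}
    (hα : 1 ≤ α) (hα2 : α ^ 2 = α + 1) {σ : List (Request X)} (hσ : ∀ r ∈ σ, 0 < r.rel)
    (hp : σ.Pairwise fun r r' => r.rel < r'.rel) :
    lazyTime A α σ ≤ ENNReal.ofReal ((1 + α) * opt c O σ.toFinset) := by
  obtain ⟨m, ⟨h1, h2, h3, h4, h5⟩, htr⟩ :=
    (Config.isReachable_init c O hα hσ hp).exists_isFinal hX hc A hα hα2 hσ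
  have hk := htr.known_union
  rw [h1, List.toFinset_nil, Finset.union_empty] at hk
  rw [hk] at h5
  exact (iInf₂_le _ ⟨m, h1, h2, h3, h4⟩).trans (ENNReal.ofReal_le_ofReal h5)

theorem opt_pos (hX : IsGeodesic X) (hc : 1 ≤ c) {M : Set X} {σ : List (Request X)}
    (hσ : IsRequestSequence M σ) : 0 < opt c O σ.toFinset := by
  obtain ⟨r, hr⟩ := List.exists_mem_of_ne_nil σ hσ.ne_nil
  exact (hσ.rel_pos r hr).trans_le (rel_le_opt hX hc (by simpa using hr))

theorem lazyRatio_le (hX : IsGeodesic X) (hc : 1 ≤ c) (A : LazyRule c O) {α : ℝ}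
    (hα : 1 ≤ α) (hα2 : α ^ 2 = α + 1) (M : Set X) :
    lazyRatio A α M ≤ ENNReal.ofReal (1 + α) := by
  refine iSup₂_le fun σ hσ => ENNReal.div_le_of_le_mul ?_
  rw [← ENNReal.ofReal_mul (by linarith)]
  exact lazyTime_le hX hc A hα hα2 hσ.rel_pos hσ.rel_lt

end DialARide

/-! ### Tracing runs for the lower bounds -/

namespace DialARide

universe u

section

variable {X : Type u} {c : ℕ∞} [MetricSpace X] {O : X} {C : Config X}

namespace Config

/-- All requests have been released and served by time `t`. -/
def IsDoneAt (C : Config X) (t : ℝ) : Prop :=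
  C.future = [] ∧ C.start ≤ t ∧ C.waitingAt t = ∅ ∧ C.loadedAt t = ∅

/-- `Lazy`, started in the configuration `C`, does not serve all requests before time `b`. -/
def NotDoneBefore (A : LazyRule c O) (α b : ℝ) (C : Config X) : Prop :=
  ∀ m t, ((next A α)^[m] C).IsDoneAt t → b ≤ t

variable {A : LazyRule c O} {α b : ℝ}

theorem NotDoneBefore.of_next (h : ∀ t, C.IsDoneAt t → b ≤ t)
    (hn : (C.next A α).NotDoneBefore A α b) : C.NotDoneBefore A α b := by
  rintro (_ | m) t ht
  · exact h t ht
  · exact hn m t ht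

/-- This closes a trace: the last configuration of a finite run is a fixed point of `next`. -/
theorem NotDoneBefore.of_next_eq (h : ∀ t, C.IsDoneAt t → b ≤ t) (hn : C.next A α = C) :
    C.NotDoneBefore A α b := by
  intro m t ht
  rw [Function.iterate_fixed hn] at ht
  exact h t ht

theorem Runs.not_isDoneAt {P : Finset (Request X)} (h : C.Runs c P) {r : Request X}
    (hr : r ∈ C.waiting) (hP : r ∉ P) (t : ℝ) : ¬ C.IsDoneAt t := by
  rintro ⟨-, -, hw, -⟩
  have : r ∈ C.waitingAt t := Finset.mem_filter.2 ⟨hr, fun hl => hP (h.load_mem_executed hl)⟩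
  simp [hw] at this

/-- A request that waits at distance `d` is not served within time `d`. -/
theorem Runs.add_dist_le_of_isDoneAt {P : Finset (Request X)} (h : C.Runs c P) {r : Request X}
    (hr : r ∈ C.waiting) {t : ℝ} (ht : C.IsDoneAt t) :
    C.start + dist (C.tour.path 0) r.src ≤ t := by
  obtain ⟨-, -, hw, -⟩ := ht
  have hex : Act.load r ∈ C.executed t := by
    by_contra hl
    have : r ∈ C.waitingAt t := Finset.mem_filter.2 ⟨hr, hl⟩
    simp [hw] at this
  rw [executed_eq] at hex
  obtain ⟨p, hp, hp'⟩ := List.mem_map.1 hex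
  have h1 : p.1 ≤ t - C.start := by simpa using (List.mem_filter.1 hp).2
  have h2 := (h.feasible.reach.of_mem (List.mem_of_mem_filter hp)).1
  rw [hp'] at h2
  simp only [Act.point] at h2
  linarith

theorem next_eq_becomeIdle (h : ∀ r l, C.future = r :: l → C.finish < r.rel) :
    C.next A α = C.becomeIdle A α := by
  unfold Config.next
  split
  · rfl
  · rename_i r l hF
    rw [if_neg (not_le.2 (h r l hF))]

theorem Runs.next_sched {P W : Finset (Request X)} (h : C.Runs c P)
    (hf : ∀ r l, C.future = r :: l → C.finish < r.rel)
    (ht : α * opt c O C.known ≤ C.finish) (hW : C.waiting \ P = W) (hne : W.Nonempty) :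
    C.next A α = ⟨C.future, C.known, W, ∅, C.finish, A.sched W (C.posAt C.finish)⟩ := by
  have hw := h.waitingAt_finish
  rw [hW] at hw
  rw [next_eq_becomeIdle hf]
  simp only [becomeIdle, if_neg ht.not_gt, hw, if_pos hne, execute, h.loadedAt_finish]

theorem Runs.next_eq_self {P : Finset (Request X)} (h : C.Runs c P) (hf : C.future = [])
    (ht : α * opt c O C.known ≤ C.finish) (hW : C.waiting \ P = ∅) : C.next A α = C := by
  have hw := h.waitingAt_finish
  rw [hW] at hw
  rw [next_eq_becomeIdle (by simp [hf])]
  simp only [becomeIdle, if_neg ht.not_gt, hw, Finset.not_nonempty_empty, if_false, hf]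

/-- The server is at the origin from time `s` to time `t`, and has not served any of the requests
in `K`, which are the known ones. -/
structure WaitsAtOrigin (c : ℕ∞) (O : X) (C : Config X) (K : Finset (Request X))
    (l : List (Request X)) (s t : ℝ) : Prop where
  runs : C.Runs c ∅
  future : C.future = l
  known : C.known = K
  waiting : C.waiting = K
  loaded : C.loaded = ∅
  start : C.start = s
  finish : C.finish = t
  posAt : ∀ u, s ≤ u → u ≤ t → C.posAt u = O

namespace WaitsAtOrigin

variable {K : Finset (Request X)} {l : List (Request X)} {r : Request X} {s t : ℝ}

theorem executed (h : C.WaitsAtOrigin c O K l s t) (u : ℝ) : C.executed u = [] := by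
  have := h.runs.feasible.serves
  rw [h.loaded] at this
  have := List.map_eq_nil_iff.1 this.eq_nil
  simp [Config.executed, this]

theorem waitingAt (h : C.WaitsAtOrigin c O K l s t) (u : ℝ) : C.waitingAt u = K := by
  simp [Config.waitingAt, h.executed, h.waiting]

theorem loadedAt (h : C.WaitsAtOrigin c O K l s t) (u : ℝ) : C.loadedAt u = ∅ := by
  simp [Config.loadedAt, h.executed, h.loaded]

theorem start_le (h : C.WaitsAtOrigin c O K l s t) : s ≤ t := by
  rw [← h.start, ← h.finish]
  exact h.runs.start_le_finish

theorem not_isDoneAt (h : C.WaitsAtOrigin c O K l s t) (hne : K.Nonempty) (u : ℝ) :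
    ¬ C.IsDoneAt u := by
  rintro ⟨-, -, hw, -⟩
  rw [h.waitingAt] at hw
  exact hne.ne_empty hw

theorem init (c : ℕ∞) (O : X) (σ : List (Request X)) :
    (init O σ).WaitsAtOrigin c O ∅ σ 0 0 :=
  ⟨⟨Tour.stay_isFeasible O le_rfl, by simp, by simp⟩, rfl, rfl, rfl, rfl, rfl,
    by simp [Config.finish, Config.init, Tour.stay], fun _ _ _ => rfl⟩

theorem execute_stay (h : C.WaitsAtOrigin c O K l s t) {d u : ℝ} (hd : 0 ≤ d) (hu : t + d = u) :
    (C.execute t (Tour.stay O d)).WaitsAtOrigin c O K l t u :=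
  ⟨runs_stay (h.loadedAt t) O hd, h.future, h.known, h.waitingAt t, h.loadedAt t, rfl, hu,
    fun _ _ _ => rfl⟩

theorem posAt_finish (h : C.WaitsAtOrigin c O K l s t) : C.posAt t = O :=
  h.posAt t h.start_le le_rfl

theorem next_idle (h : C.WaitsAtOrigin c O ∅ (r :: l) s t) (h0 : 0 ≤ t) (hr : t < r.rel) :
    (C.next A α).WaitsAtOrigin c O ∅ (r :: l) t r.rel := by
  have hopt : opt c O (∅ : Finset (Request X)) = 0 :=
    le_antisymm (opt_le (Tour.stay_isFeasible O le_rfl) (by simp [Tour.RespectsRelease, Tour.stay]))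
      (opt_nonneg _ _ _)
  have hn : C.next A α = C.execute t (Tour.stay O (r.rel - t)) := by
    rw [next_eq_becomeIdle]
    · simp [becomeIdle, h.finish, h.known, hopt, h0.not_gt, h.waitingAt, h.future, h.posAt_finish]
    · intro q l' hq
      rw [h.future, List.cons.injEq] at hq
      rw [h.finish, ← hq.1]
      exact hr
  rw [hn]
  exact h.execute_stay (by linarith) (by ring)

theorem next_wait (h : C.WaitsAtOrigin c O K l s t) (hl : ∀ r l', l = r :: l' → t < r.rel)
    (ht : t < α * opt c O K) :
    (C.next A α).WaitsAtOrigin c O K l t (α * opt c O K) := by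
  have hn : C.next A α = C.execute t (Tour.stay O (α * opt c O K - t)) := by
    rw [next_eq_becomeIdle]
    · simp [becomeIdle, h.finish, h.known, ht, h.posAt_finish]
    · rwa [h.future, h.finish]
  rw [hn]
  exact h.execute_stay (by linarith) (by ring)

/-- Returning takes no time for an empty server at the origin, and `r.rel` ≤ opt ≤ α·opt, so the
return is accepted. It ends at once, and the server then waits for the new deadline. -/
theorem next_receive (hX : IsGeodesic X) (hc : 1 ≤ c) (hα : 1 ≤ α)
    (h : C.WaitsAtOrigin c O K (r :: l) s t) (h0 : 0 ≤ r.rel) (hs : s ≤ r.rel) (hr : r.rel ≤ t) :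
    (C.next A α).WaitsAtOrigin c O (insert r K) l r.rel r.rel := by
  have hdur : (A.ret O ∅).dur = 0 := by
    refine le_antisymm ?_ (A.ret_shortest O ∅).1.1.dur_nonneg
    have := (A.ret_shortest O ∅).dur_le hX (t := 0) (l := []) (D := 0) (by simp [Reach]) ⟨rfl, rfl⟩
    linarith
  have hrel : r.rel ≤ opt c O (insert r K) := rel_le_opt hX hc (Finset.mem_insert_self _ _)
  have hle : r.rel ≤ α * opt c O (insert r K) := by nlinarith
  have hpos : (C.reveal r l).posAt r.rel = O := h.posAt _ hs hr
  have hex : (C.reveal r l).executed r.rel = [] := h.executed r.rel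
  have hld : (C.reveal r l).loadedAt r.rel = ∅ := by
    have : (C.reveal r l).loaded = ∅ := h.loaded
    simp [Config.loadedAt, this, hex]
  have hw : (C.reveal r l).waitingAt r.rel = insert r K := by
    have : (C.reveal r l).waiting = insert r K := by simp [Config.reveal, h.waiting]
    simp [Config.waitingAt, this, hex]
  have hk : (C.reveal r l).known = insert r K := by simp [Config.reveal, h.known]
  have hn : C.next A α = (C.reveal r l).execute r.rel
      (A.ret O ((C.reveal r l).loadedAt r.rel)) := by
    simp only [Config.next, h.future, h.finish, if_pos hr, Config.receive, hpos, hk]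
    rw [hld, hdur, add_zero, if_pos hle]
  rw [hn]
  refine ⟨runs_ret A _ _ _, rfl, hk, hw, hld, rfl, ?_, fun u h1 h2 => ?_⟩
  · simp [Config.finish, execute, hld, hdur]
  · rw [le_antisymm h2 h1]
    simp only [Config.posAt, execute, hld, sub_self]
    exact (A.ret_shortest O ∅).1.1.path_zero

theorem next_sched (h : C.WaitsAtOrigin c O K l s t) (hl : ∀ r l', l = r :: l' → t < r.rel)
    (ht : α * opt c O K ≤ t) (hne : K.Nonempty) :
    C.next A α = ⟨l, K, K, ∅, t, A.sched K O⟩ := by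
  have := h.runs.next_sched (A := A) (α := α) (W := K) (by rwa [h.future, h.finish])
    (by rwa [h.known, h.finish]) (by simp [h.waiting]) hne
  rw [this, h.future, h.known, h.finish, h.posAt_finish]

end WaitsAtOrigin

theorem runs_sched_mk (A : LazyRule c O) (l : List (Request X)) (K W P : Finset (Request X))
    (t : ℝ) (x : X) (hP : P ⊆ W) : (⟨l, K, W, ∅, t, A.sched P x⟩ : Config X).Runs c P where
  feasible := by
    have := (A.sched_shortest P x).1
    simpa only [this.path_zero] using this
  subset := hP
  disjoint := by simp

end Config

theorem le_lazyTime {A : LazyRule c O} {α b : ℝ} {σ : List (Request X)}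
    (h : (Config.init O σ).NotDoneBefore A α b) : ENNReal.ofReal b ≤ lazyTime A α σ :=
  le_iInf₂ fun t ⟨m, hm⟩ => ENNReal.ofReal_le_ofReal (h m t hm)

theorem le_lazyRatio (hX : IsGeodesic X) (hc : 1 ≤ c) {A : LazyRule c O} {α b B D : ℝ}
    {M : Set X} {σ : List (Request X)} (hσ : IsRequestSequence M σ)
    (h : (Config.init O σ).NotDoneBefore A α B) (hD : opt c O σ.toFinset ≤ D) (hb : 0 ≤ b)
    (hB : b * D ≤ B) : ENNReal.ofReal b ≤ lazyRatio A α M := by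
  refine le_trans ?_ (le_iSup₂ (f := fun σ (_ : IsRequestSequence M σ) =>
    lazyTime A α σ / ENNReal.ofReal (opt c O σ.toFinset)) σ hσ)
  have hpos := opt_pos (c := c) (O := O) hX hc hσ
  rw [ENNReal.le_div_iff_mul_le (Or.inl (by simpa using hpos)) (Or.inl ENNReal.ofReal_ne_top),
    ← ENNReal.ofReal_mul hb]
  refine le_trans (ENNReal.ofReal_le_ofReal ?_) (le_lazyTime h)
  nlinarith

end

/-! ### The real line and the instance with one request -/

theorem isGeodesic_real : IsGeodesic ℝ := by
  intro x y
  rcases le_total x y with h | h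
  · refine ⟨fun s => x + s, by simp, ?_, fun s _ t _ => by simp [Real.dist_eq]⟩
    rw [Real.dist_eq, abs_sub_comm, abs_of_nonneg (by linarith)]
    ring
  · refine ⟨fun s => x - s, by simp, ?_, fun s _ t _ => ?_⟩
    · rw [Real.dist_eq, abs_of_nonneg (by linarith)]
      ring
    · rw [Real.dist_eq, abs_sub_comm]
      congr 1
      ring

-- A request at the point 1, released at time 1/2, has optimum 1, which is the travel time. The
-- server leaves the origin at time α and needs one more unit.
open Config in
theorem one_add_le_lazyRatio {c : ℕ∞} (hc : 1 ≤ c) (A : LazyRule c (0 : ℝ)) {α : ℝ} (hα : 1 ≤ α) :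
    ENNReal.ofReal (1 + α) ≤ lazyRatio A α Set.univ := by
  have hX := isGeodesic_real
  obtain ⟨r, hr⟩ : ∃ r : Request ℝ, r = ⟨1, 1, 1 / 2⟩ := ⟨_, rfl⟩
  have hrel : r.rel = 1 / 2 := by rw [hr]
  have hsrc : r.src = 1 := by rw [hr]
  have hdst : r.dst = 1 := by rw [hr]
  have hopt : opt c (0 : ℝ) (insert r ∅) = 1 := by
    refine le_antisymm ?_ ?_
    · refine opt_le_of_reach hX (l := [(1, Act.load r), (1, Act.unload r)]) (z := 1) ?_
        (Serves.cons_cons hc (Finset.notMem_empty r) ⟨rfl, rfl⟩) ?_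
      · simp [Reach, Act.point, hsrc, hdst]
      · intro s q hq
        simp only [List.mem_cons, Prod.mk.injEq, Act.load.injEq, reduceCtorEq, and_false,
          List.not_mem_nil, or_false] at hq
        rw [hq.1, hq.2, hrel]
        norm_num
    · have := dist_dst_le_opt (O := (0 : ℝ)) hX hc (Finset.mem_insert_self r ∅)
      simpa [hdst] using this
  refine le_lazyRatio (σ := [r]) (B := 1 + α) (D := 1) hX hc
    ⟨by simp, by simp [hrel], by simp, by simp, by simp⟩ ?_ (by simpa using hopt.le) (by linarith)
    (by simp)
  have hw0 := WaitsAtOrigin.init c (0 : ℝ) [r]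
  refine .of_next (fun t ht => absurd ht.1 (by simp [Config.init])) ?_
  have hw1 := hw0.next_idle (A := A) (α := α) le_rfl (by rw [hrel]; norm_num)
  refine .of_next
    (fun t ht => absurd ht.1 (by simp [hw1.future])) ?_
  have hw2 := hw1.next_receive (A := A) hX hc hα (by rw [hrel]; norm_num) (by rw [hrel]; norm_num)
    le_rfl
  refine .of_next (fun t ht => (hw2.not_isDoneAt (by simp) t ht).elim) ?_
  have hw3 := hw2.next_wait (A := A) (α := α) (by simp) (by rw [hrel, hopt]; linarith)
  refine .of_next (fun t ht => (hw3.not_isDoneAt (by simp) t ht).elim) ?_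
  rw [hw3.next_sched (by simp) le_rfl (by simp)]
  have hruns := runs_sched_mk A [] (insert r ∅) (insert r ∅) (insert r ∅)
    (α * opt c 0 (insert r ∅)) 0 subset_rfl
  refine .of_next_eq (fun t ht => ?_) (hruns.next_eq_self rfl hruns.start_le_finish (by simp))
  have := hruns.add_dist_le_of_isDoneAt (Finset.mem_insert_self r ∅) ht
  rw [(A.sched_shortest (insert r ∅) 0).1.path_zero, hsrc, hopt] at this
  simp at this
  linarith

end DialARide

/-! ### The instance with three requests -/

namespace DialARide

section

variable {c : ℕ∞} {q q' : Request ℝ} {T : Tour ℝ}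

/-- A schedule from the origin for two requests that start at the origin and have destinations at
distance one on different sides takes time at least three. If it takes time three, then it
begins with loading one of them, and it ends at the destination of the other one. -/
theorem three_le_dur (hq : q.src = 0) (hq' : q'.src = 0) (hd : q.dst = 1) (hd' : q'.dst = -1)
    {P : Finset (Request ℝ)} (hP : q ∈ P) (hP' : q' ∈ P) (hT : T.IsFeasible c P ∅ 0) :
    3 ≤ T.dur ∧ (T.dur ≤ 3 → ((0, Act.load q) ∈ T.acts ∧ T.path T.dur = -1) ∨
      ((0, Act.load q') ∈ T.acts ∧ T.path T.dur = 1)) := by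
  obtain ⟨s, u, hs, hu, h1, h2, h3⟩ := hT.exists_load_unload hP
  obtain ⟨s', u', hs', hu', h1', h2', h3'⟩ := hT.exists_load_unload hP'
  have hdist := hT.speed.dist_le_mul _ (hT.time_mem _ hu) _ (hT.time_mem _ hu')
  have hum := (hT.time_mem _ hu).2
  have hum' := (hT.time_mem _ hu').2
  rw [hT.path_time _ hu, hT.path_time _ hu'] at hdist
  simp only [Reach, Act.point, hq, hq', hd, hd', Real.dist_eq] at h1 h2 h3 h1' h2' h3' hdist hum hum'
  norm_num at h1 h2 h1' h2' hdist
  -- The first delivery takes at least 1 after its loading, and crossing to the other side takes 2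
  -- more. Total time 3 leaves no slack, which fixes the loading time and the end point.
  rcases le_total u u' with huu | huu
  · rw [abs_sub_comm, abs_of_nonneg (by linarith)] at hdist
    refine ⟨by linarith, fun hdur => Or.inl ⟨?_, ?_⟩⟩
    · have : s = 0 := by linarith
      rwa [this] at hs
    · have h4 := le_abs_self (-1 - T.path T.dur)
      have h5 := neg_abs_le (-1 - T.path T.dur)
      linarith
  · rw [abs_of_nonneg (by linarith)] at hdist
    refine ⟨by linarith, fun hdur => Or.inr ⟨?_, ?_⟩⟩
    · have : s' = 0 := by linarith
      rwa [this] at hs'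
    · have h4 := le_abs_self (1 - T.path T.dur)
      have h5 := neg_abs_le (1 - T.path T.dur)
      linarith

/-- With `δ = 0` this is a schedule ignoring release times; with `δ > 0` it is an offline solution
that first waits for both releases. -/
theorem reach_pair {δ : ℝ} (hδ : 0 ≤ δ) (hq : q.src = 0) (hq' : q'.src = 0) (hd : |q.dst| = 1)
    (hd' : |q'.dst| = 1) : Reach 0 (0 : ℝ) [(δ, Act.load q'), (δ + 1, Act.unload q'),
      (δ + 2, Act.load q), (δ + 3, Act.unload q)] (δ + 3) q.dst := by
  simp [Reach, Act.point, hq, hq', Real.dist_eq, hd, hd', hδ]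
  norm_num

end

open Config in
/-- The run of `Lazy` after it has started to serve two requests at the origin, loading `q` first,
when a third request appears on the side of `q`. -/
theorem notDoneBefore_of_sched {c : ℕ∞} {A : LazyRule c (0 : ℝ)} {α δ t : ℝ} (hα : 1 ≤ α)
    (hδ : 0 ≤ δ) (hδ1 : δ < 1) {K : Finset (Request ℝ)} {q r : Request ℝ} (hq : q ∈ K)
    (hr : r ∉ K) (hd : |q.dst| = 1) (hsrc : r.src = (3 * α - 2) * q.dst) (hrel : r.rel = t + δ)
    (hdur : (A.sched K 0).dur = 3) (hload : (0, Act.load q) ∈ (A.sched K 0).acts)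
    (hend : (A.sched K 0).path (A.sched K 0).dur = -q.dst)
    (hopt : α * opt c 0 (insert r K) < t + 2) :
    (⟨[r], K, K, ∅, t, A.sched K 0⟩ : Config ℝ).NotDoneBefore A α (t + (3 * α + 2)) := by
  set C : Config ℝ := ⟨[r], K, K, ∅, t, A.sched K 0⟩ with hC
  have hruns : C.Runs c K := runs_sched_mk A [r] K K K t 0 subset_rfl
  have hfin : C.finish = t + 3 := by rw [← hdur]; rfl
  have hS := (A.sched_shortest K 0).1
  refine .of_next (fun _ ht => absurd ht.1 (by simp [hC])) ?_
  have hruns' : (C.reveal r []).Runs c K := hruns.reveal r []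
  have hdelta : (C.reveal r []).start + δ = r.rel := hrel.symm
  -- `q` was loaded at time `t`, and its destination at distance 1 is out of reach within `δ < 1`.
  have hqload : q ∈ (C.reveal r []).loadedAt r.rel := by
    rw [hruns'.loadedAt_eq]
    simp only [Finset.mem_filter, Finset.mem_union, executed_eq]
    refine ⟨Or.inr ⟨hq, ?_⟩, ?_⟩
    · refine List.mem_map.2 ⟨_, List.mem_filter.2 ⟨hload, ?_⟩, rfl⟩
      simp only [decide_eq_true_eq]
      linarith
    · intro h
      obtain ⟨p, hp, hp'⟩ := List.mem_map.1 h
      have h1 : p.1 ≤ r.rel - (C.reveal r []).start := by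
        simpa using (List.mem_filter.1 hp).2
      have h2 := (hS.reach.of_mem (List.mem_of_mem_filter hp)).1
      rw [hp'] at h2
      simp only [Act.point, dist_zero_left, Real.norm_eq_abs, hd] at h2
      linarith
  -- The server is within `δ` of the origin: at least `1 - δ` to deliver `q`, then 1 to come back.
  have hret : r.rel + 2 - δ ≤ r.rel + (A.ret ((C.reveal r []).posAt r.rel)
      ((C.reveal r []).loadedAt r.rel)).dur := by
    have hR := (A.ret_shortest ((C.reveal r []).posAt r.rel) ((C.reveal r []).loadedAt r.rel)).1
    obtain ⟨p, hp, hp'⟩ := List.mem_map.1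
      (hR.1.serves.unload_mem (r := q) (by simpa using hqload))
    have h1 := hR.1.reach.of_mem hp
    have h2 : dist (0 : ℝ) ((C.reveal r []).posAt r.rel) ≤ δ := by
      have h3 := hS.speed.dist_le_mul 0 ⟨le_rfl, hS.dur_nonneg⟩ δ ⟨hδ, by linarith⟩
      rw [hS.path_zero, Real.dist_eq 0 δ, zero_sub, abs_neg, abs_of_nonneg hδ] at h3
      have h4 : r.rel - (C.reveal r []).start = δ := by linarith
      simp only [Config.posAt, h4]
      change dist 0 ((A.sched K 0).path δ) ≤ δ
      simpa using h3
    rw [hp', hR.2] at h1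
    have h5 := dist_triangle (0 : ℝ) ((C.reveal r []).posAt r.rel) q.dst
    simp only [Act.point, dist_zero_left, dist_zero_right, Real.norm_eq_abs, hd] at h1 h2 h5
    linarith
  have hn : C.next A α = C.reveal r [] := by
    have h1 : r.rel ≤ C.finish := by rw [hfin]; linarith
    have h2 : C.next A α = C.receive A α r [] := by
      simp only [Config.next, hC]
      exact if_pos h1
    rw [h2]
    simp only [Config.receive]
    refine if_neg (not_le.2 (lt_of_lt_of_le ?_ hret))
    change α * opt c 0 (insert r K) < _
    linarith
  rw [hn]
  refine .of_next
    (fun t ht => (hruns'.not_isDoneAt (Finset.mem_insert_self r K) hr t ht).elim) ?_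
  have hpos : (C.reveal r []).posAt (C.reveal r []).finish = -q.dst := by
    rw [posAt_finish]
    exact hend
  have hidle : α * opt c 0 (C.reveal r []).known ≤ (C.reveal r []).finish := by
    change α * opt c 0 (insert r K) ≤ C.finish
    linarith
  have hW : (C.reveal r []).waiting \ K = {r} := by
    change insert r K \ K = {r}
    rw [Finset.insert_sdiff_of_notMem _ hr, Finset.sdiff_self]
    rfl
  rw [hruns'.next_sched (A := A) (W := {r}) (by simp [Config.reveal]) hidle hW (by simp), hpos]
  have hruns'' := runs_sched_mk A (C.reveal r []).future (C.reveal r []).known {r} {r}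
    (C.reveal r []).finish (-q.dst) subset_rfl
  refine .of_next_eq (fun u hu => ?_)
    (hruns''.next_eq_self rfl (hidle.trans hruns''.start_le_finish) (by simp))
  -- At time `t + 3` the server is at `-q.dst`, at distance (3α - 2) + 1 from the last request.
  have h1 := hruns''.add_dist_le_of_isDoneAt (Finset.mem_singleton_self r) hu
  change C.finish + dist ((A.sched {r} (-q.dst)).path 0) r.src ≤ u at h1
  rw [(A.sched_shortest {r} (-q.dst)).1.path_zero, hfin, hsrc, Real.dist_eq, abs_sub_comm,
    sub_neg_eq_add, ← add_one_mul, abs_mul, hd, abs_of_nonneg (by linarith)] at h1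
  linarith

open Config in
/-- The instance with two requests at the origin and a third one far away. -/
theorem le_lazyRatio_of_small {c : ℕ∞} (hc : 1 ≤ c) (A : LazyRule c (0 : ℝ)) {α b δ : ℝ}
    (hα : 1 ≤ α) (hδ : 0 < δ) (hδ1 : δ < 1) (hδα : 3 * α ^ 2 - 3 * α + α ^ 2 * δ < 2)
    (hb : 1 ≤ b) (hbδ : (b - 1) * (α * (3 + δ)) + b * δ ≤ 3 * α + 2) :
    ENNReal.ofReal b ≤ lazyRatio A α Set.univ := by
  have hX := isGeodesic_real
  obtain ⟨r₁, hr₁⟩ : ∃ r : Request ℝ, r = ⟨0, 1, δ / 2⟩ := ⟨_, rfl⟩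
  obtain ⟨r₂, hr₂⟩ : ∃ r : Request ℝ, r = ⟨0, -1, δ⟩ := ⟨_, rfl⟩
  have hrel₁ : r₁.rel = δ / 2 := by rw [hr₁]
  have hrel₂ : r₂.rel = δ := by rw [hr₂]
  have hsrc₁ : r₁.src = 0 := by rw [hr₁]
  have hsrc₂ : r₂.src = 0 := by rw [hr₂]
  have hdst₁ : r₁.dst = 1 := by rw [hr₁]
  have hdst₂ : r₂.dst = -1 := by rw [hr₂]
  have hne : r₁ ≠ r₂ := fun h => by rw [h, hrel₂] at hrel₁; linarith
  set K : Finset (Request ℝ) := insert r₂ (insert r₁ ∅) with hK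
  have hm₁ : r₁ ∈ K := by simp [hK]
  have hm₂ : r₂ ∈ K := by simp [hK]
  have hrelK : ∀ r ∈ K, r.rel ≤ δ := by
    intro r hr
    simp only [hK, Finset.mem_insert, Finset.notMem_empty, or_false] at hr
    rcases hr with rfl | rfl <;> linarith
  -- the optimum for the first two requests
  have hopt_ge : 3 ≤ opt c 0 K := le_opt hX hc fun T hT _ =>
    (three_le_dur hsrc₁ hsrc₂ hdst₁ hdst₂ hm₁ hm₂ hT).1
  have hserves : Serves c K ∅ [Act.load r₂, Act.unload r₂, Act.load r₁, Act.unload r₁] :=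
    Serves.cons_cons hc (by simp [hne.symm]) (Serves.cons_cons hc (by simp) ⟨rfl, rfl⟩)
  have hreach := fun δ (hδ : 0 ≤ δ) =>
    reach_pair hδ hsrc₁ hsrc₂ (by simp [hdst₁]) (by simp [hdst₂])
  have hopt_le : opt c 0 K ≤ δ + 3 := by
    refine opt_le_of_reach hX (hreach δ hδ.le) hserves ?_
    intro s r hr
    simp only [List.mem_cons, Prod.mk.injEq, Act.load.injEq, reduceCtorEq, and_false, false_or,
      List.not_mem_nil, or_false] at hr
    rcases hr with ⟨rfl, rfl⟩ | ⟨rfl, rfl⟩ <;> linarith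
  set t := α * opt c 0 K with ht
  have ht_ge : 3 * α ≤ t := by nlinarith
  have ht_le : t ≤ α * (3 + δ) := by nlinarith
  -- the shortest schedule for them
  have hS := A.sched_shortest K 0
  have hdur : (A.sched K 0).dur = 3 := by
    refine le_antisymm ?_ (three_le_dur hsrc₁ hsrc₂ hdst₁ hdst₂ hm₁ hm₂ hS.1).1
    have := hS.dur_le hX (hreach 0 le_rfl) hserves
    linarith
  -- The tie-breaking rule decides which request is loaded first; calling it `q`, the adversary
  -- adapts the side of the third request.
  obtain ⟨q, q', hqq, hKq, hq, hq', hd, hdd, hload, hend⟩ : ∃ q q' : Request ℝ, q ≠ q' ∧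
      K = insert q' (insert q ∅) ∧ q.src = 0 ∧ q'.src = 0 ∧ |q.dst| = 1 ∧ |q'.dst| = 1 ∧
      (0, Act.load q) ∈ (A.sched K 0).acts ∧
      (A.sched K 0).path (A.sched K 0).dur = -q.dst := by
    rcases (three_le_dur hsrc₁ hsrc₂ hdst₁ hdst₂ hm₁ hm₂ hS.1).2 hdur.le with h | h
    · exact ⟨r₁, r₂, hne, rfl, hsrc₁, hsrc₂, by simp [hdst₁], by simp [hdst₂], h.1,
        by rw [h.2, hdst₁]⟩
    · exact ⟨r₂, r₁, hne.symm, Finset.insert_comm _ _ _, hsrc₂, hsrc₁, by simp [hdst₂],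
        by simp [hdst₁], h.1, by rw [h.2, hdst₂, neg_neg]⟩
  have hqK : q ∈ K := by simp [hKq]
  have hqK' : q' ∈ K := by simp [hKq]
  -- the third request
  obtain ⟨r, hr⟩ : ∃ r : Request ℝ, r = ⟨(3 * α - 2) * q.dst, (3 * α - 2) * q.dst, t + δ⟩ :=
    ⟨_, rfl⟩
  have hrel : r.rel = t + δ := by rw [hr]
  have hsrc : r.src = (3 * α - 2) * q.dst := by rw [hr]
  have hdst : r.dst = (3 * α - 2) * q.dst := by rw [hr]
  have hrK : r ∉ K := fun h => by linarith [hrelK r h]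
  have hopt : opt c 0 (insert r K) ≤ t + δ := by
    have hset : insert r K = insert q' (insert q (insert r ∅)) := by
      rw [hKq]
      ext x
      simp only [Finset.mem_insert, Finset.notMem_empty, or_false]
      tauto
    rw [hset]
    have hrq : q ≠ r := fun h => hrK (h ▸ hqK)
    have hrq' : q' ≠ r := fun h => hrK (h ▸ hqK')
    refine opt_le_of_reach hX (z := r.dst)
      (l := [(δ, Act.load q'), (δ + 1, Act.unload q'), (δ + 2, Act.load q), (δ + 3, Act.unload q),
        (t + δ, Act.load r), (t + δ, Act.unload r)]) ?_
      (Serves.cons_cons hc (by simp [hqq.symm, hrq']) (Serves.cons_cons hc (by simp [hrq])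
        (Serves.cons_cons hc (by simp) ⟨rfl, rfl⟩))) ?_
    · obtain ⟨h1, h2, h3, h4, -⟩ := reach_pair hδ.le hq hq' hd hdd
      refine ⟨h1, h2, h3, h4, ?_, ?_, ?_⟩
      · simp only [Act.point, hsrc]
        rw [Real.dist_eq, abs_sub_comm, ← sub_one_mul, abs_mul, hd, abs_of_nonneg (by linarith)]
        linarith
      · simp [Act.point, hsrc, hdst]
      · simp [Act.point, Reach]
    · intro s p hp
      simp only [List.mem_cons, Prod.mk.injEq, Act.load.injEq, reduceCtorEq, and_false, false_or,
        List.not_mem_nil, or_false] at hp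
      rcases hp with ⟨rfl, rfl⟩ | ⟨rfl, rfl⟩ | ⟨rfl, rfl⟩
      · exact hrelK _ hqK'
      · linarith [hrelK _ hqK]
      · exact hrel.le
  -- the run
  refine le_lazyRatio (σ := [r₁, r₂, r]) (B := t + (3 * α + 2)) (D := t + δ) hX hc
    ⟨by simp, ?_, ?_, by simp, by simp⟩ ?_ ?_ (by linarith) ?_
  · intro x hx
    simp only [List.mem_cons, List.not_mem_nil, or_false] at hx
    rcases hx with rfl | rfl | rfl <;> linarith
  · simp only [List.pairwise_cons, List.mem_cons, List.not_mem_nil, or_false, forall_eq_or_imp,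
      forall_eq, hrel₁, hrel₂, hrel, List.Pairwise.nil, and_true, IsEmpty.forall_iff,
      implies_true]
    refine ⟨⟨?_, ?_⟩, ?_⟩ <;> linarith
  · have hopt₁ : 1 ≤ opt c 0 (insert r₁ ∅) := by
      have := dist_dst_le_opt (O := (0 : ℝ)) hX hc (Finset.mem_insert_self r₁ ∅)
      simpa [hdst₁] using this
    have hw0 := WaitsAtOrigin.init c (0 : ℝ) [r₁, r₂, r]
    refine .of_next (fun t ht => absurd ht.1 (by simp [Config.init])) ?_
    have hw1 := hw0.next_idle (A := A) (α := α) le_rfl (by linarith)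
    refine .of_next (fun t ht => absurd ht.1 (by simp [hw1.future])) ?_
    have hw2 := hw1.next_receive (A := A) hX hc hα (by linarith) (by linarith) le_rfl
    refine .of_next (fun t ht => (hw2.not_isDoneAt (by simp) t ht).elim) ?_
    have hw3 := hw2.next_wait (A := A) (α := α) (by
      rintro _ _ ⟨⟩
      linarith) (by nlinarith)
    refine .of_next (fun t ht => (hw3.not_isDoneAt (by simp) t ht).elim) ?_
    have hw4 := hw3.next_receive (A := A) hX hc hα (by linarith) (by linarith) (by nlinarith)
    refine .of_next (fun t ht => (hw4.not_isDoneAt (by simp) t ht).elim) ?_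
    have hw5 := hw4.next_wait (A := A) (α := α) (by
      rintro _ _ ⟨⟩
      linarith) (by rw [← hK, ← ht]; linarith)
    refine .of_next (fun t ht => (hw5.not_isDoneAt (by simp) t ht).elim) ?_
    rw [hw5.next_sched (by
      rintro _ _ ⟨⟩
      rw [← hK, ← ht]
      linarith) le_rfl (by simp), ← hK, ← ht]
    -- As `t ≤ α * (3 + δ)`, the condition `hδα` yields α(`t` + `δ`) < `t` + 2, so the return is
    -- refused.
    exact notDoneBefore_of_sched hα hδ.le hδ1 hqK hrK hd hsrc hrel hdur hload hend (by nlinarith)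
  · convert hopt using 2
    ext x
    simp only [hK, List.toFinset_cons, List.toFinset_nil, Finset.mem_insert,
      Finset.notMem_empty, or_false]
    tauto
  · nlinarith

/-- As `δ` tends to 0, the ratio of the instance tends to (3α + 3α + 2)/(3α), so each smaller `b` is
reached. The condition `hα'` says precisely that this bound exceeds `1 + α`. -/
theorem two_add_le_lazyRatio {c : ℕ∞} (hc : 1 ≤ c) (A : LazyRule c (0 : ℝ)) {α : ℝ} (hα : 1 ≤ α)
    (hα' : 3 * α ^ 2 - 3 * α < 2) :
    ENNReal.ofReal (2 + 2 / (3 * α)) ≤ lazyRatio A α Set.univ := by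
  refine le_of_forall_lt_imp_le_of_dense fun y hy => ?_
  have hy_top : y ≠ ⊤ := (hy.trans_le le_top).ne
  have hB : 0 < 2 / (3 * α) := by positivity
  have hlt : max y.toReal 1 < 2 + 2 / (3 * α) := by
    refine max_lt ?_ (by linarith)
    exact (ENNReal.lt_ofReal_iff_toReal_lt hy_top).1 hy
  set b := max y.toReal 1 with hb
  have hb1 : 1 ≤ b := le_max_right _ _
  have hyb : y ≤ ENNReal.ofReal b := by
    rw [← ENNReal.ofReal_toReal hy_top]
    exact ENNReal.ofReal_le_ofReal (le_max_left _ _)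
  refine hyb.trans ?_
  have hgap : 0 < 6 * α + 2 - 3 * α * b := by
    have : 3 * α * (2 + 2 / (3 * α)) = 6 * α + 2 := by
      field_simp
      ring
    nlinarith
  have hb3 : b ≤ 3 := by
    have : 2 / (3 * α) ≤ 1 := by
      rw [div_le_one (by positivity)]
      linarith
    linarith
  have hα2 : 0 < α ^ 2 := by positivity
  -- The second bound on `δ` is the refusal condition; the third gives the ratio `b`, where `b ≤ 3`
  -- bounds the terms in `δ` by `(2 * α + 3) * δ`.
  obtain ⟨δ, hδ, hδ'⟩ := exists_between (show (0 : ℝ) < min 1 (min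
    ((2 - (3 * α ^ 2 - 3 * α)) / α ^ 2) ((6 * α + 2 - 3 * α * b) / (2 * α + 3))) by
      refine lt_min one_pos (lt_min (div_pos (by linarith) hα2) (div_pos hgap (by linarith))))
  rw [lt_min_iff, lt_min_iff, lt_div_iff₀ hα2, lt_div_iff₀ (by linarith)] at hδ'
  obtain ⟨h1, h2, h3⟩ := hδ'
  refine le_lazyRatio_of_small hc A hα hδ h1 (by linarith) hb1 ?_
  have h4 : (b - 1) * (α * δ) ≤ 2 * (α * δ) := by
    have : 0 ≤ α * δ := by positivity
    nlinarith
  nlinarith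

end DialARide

open DialARide
theorem theorem1 (c : ℕ∞) (hc : 1 ≤ c) :
    -- upper bound on general metric spaces `M`; the server moves in a geodesic space `X ⊇ M`
    (∀ (M : Type*) [MetricSpace M] (X : Type*) [MetricSpace X] (ι : M → X) (O : M),
      Isometry ι → IsGeodesic X →
        Nonempty (LazyRule c (ι O)) ∧
        ∀ A : LazyRule c (ι O),
          lazyRatio A Real.goldenRatio (Set.range ι) ≤ ENNReal.ofReal (1 + Real.goldenRatio)) ∧
    -- the upper bound is attained, already on the real line
    (∀ A : LazyRule c (0 : ℝ),
      lazyRatio A Real.goldenRatio Set.univ = ENNReal.ofReal (1 + Real.goldenRatio)) ∧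
    -- lower bound for all parameters, on the real line
    (∀ α : ℝ, 1 ≤ α → ∀ A : LazyRule c (0 : ℝ),
      ENNReal.ofReal (max (1 + α) (2 + 2 / (3 * α))) ≤ lazyRatio A α Set.univ) := by
  have hφ := Real.one_lt_goldenRatio.le
  refine ⟨fun M _ X _ ι O _ hX => ⟨nonempty_lazyRule hX hc _, fun A =>
      lazyRatio_le hX hc A hφ Real.goldenRatio_sq _⟩,
    fun A => le_antisymm (lazyRatio_le isGeodesic_real hc A hφ Real.goldenRatio_sq _)
      (one_add_le_lazyRatio hc A hφ), fun α hα A => ?_⟩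
  rcases le_or_gt (2 + 2 / (3 * α)) (1 + α) with h | h
  · rw [max_eq_left h]
    exact one_add_le_lazyRatio hc A hα
  · rw [max_eq_right h.le]
    refine two_add_le_lazyRatio hc A hα ?_
    have h1 : α - 1 < 2 / (3 * α) := by linarith
    rw [lt_div_iff₀ (by positivity)] at h1
    linarith
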